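/- All algebras are over $\mathbb C$ and need not be unital; $M(\cdot)$ denotes the multiplier algebra. Let $(A,\Delta)$ be an algebraic quantum group: the product of $A$ is non-degenerate, $\Delta:A\to M(A\otimes A)$ is a coassociative homomorphism such that $a\otimes b\mapsto\Delta(a)(1\otimes b)$ and $a\otimes b\mapsto(a\otimes 1)\Delta(b)$ are bijections of $A\otimes A$ onto itself, the same holds for the flipped coproduct (regularity), and there is a left integral, i.e. a non-zero linear functional $\varphi$ on $A$ with $(\iota\otimes\varphi)\Delta(a)=\varphi(a)1$ in $M(A)$ for all $a\in A$. Fix $\varphi$. Let $B=\widehat A=\{\varphi(\,\cdot\,c): c\in A\}$ be the dual, paired with $A$ by evaluation, $\langle a,\varphi(\,\cdot\,c)\rangle=\varphi(ac)$. Its product is given by $\langle a,bb'\rangle=\langle\Delta(a),b\otimes b'\rangle$ and its coproduct by $\langle a\otimes a',\Delta(b)\rangle=\langle aa',b\rangle$. Let $b\triangleright a=(\iota\otimes\langle\,\cdot\,,b\rangle)\Delta(a)\in A$ be the left action of $B$ on $A$. The Heisenberg algebra $AB$ is the vector space $A\otimes B$ with the product $$(a\otimes b)(a'\otimes b')=\sum_{(a')(b)}\langle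 a'_{(2)},b_{(1)}\rangle\,aa'_{(1)}\otimes b_{(2)}b',$$ that is, $(a\otimes b)(a'\otimes b')=\sum_i a(p_i\triangleright a')\otimes q_i$ where $\sum_i p_i\otimes q_i=\Delta(b)(1\otimes b')\in B\otimes B$. Proposition 3.16. The Heisenberg algebra $AB$ is isomorphic, as an algebra, with the algebra of operators on $A$ spanned by the rank one operators $x\mapsto a\langle x,b\rangle$ with $a\in A$ and $b\in B$. An isomorphism is given by the action of $AB$ on $A$, which sends $a\otimes b$ to the operator $x\mapsto a(b\triangleright x)$. -/

import Mathlib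

open scoped TensorProduct

set_option linter.unusedSectionVars false

noncomputable section

namespace QGroup

section Multipliers

variable (A : Type*) [NonUnitalRing A] [Module ℂ A] [SMulCommClass ℂ A A] [IsScalarTower ℂ A A]

/-- The product of `A` is non-degenerate. -/
def Nondegenerate : Prop :=
  (∀ a : A, (∀ b, a * b = 0) → a = 0) ∧ (∀ a : A, (∀ b, b * a = 0) → a = 0)

/-- The multiplier algebra, as a subalgebra of `End(A) × End(A)ᵒᵖ`: pairs `(L, R)` of linear maps
`A → A`, thought of as `L a = m a` and `R a = a m`, with `m (a b) = (m a) b`, `(a b) m = a (b m)` and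
`(a m) b = a (m b)`.  The product is `m n = (L_m ∘ L_n, R_n ∘ R_m)`. -/
def multiplierSubalgebra : Subalgebra ℂ (Module.End ℂ A × (Module.End ℂ A)ᵐᵒᵖ) where
  carrier := {m | (∀ a b, m.1 (a * b) = m.1 a * b) ∧
    (∀ a b, m.2.unop (a * b) = a * m.2.unop b) ∧ (∀ a b, m.2.unop a * b = a * m.1 b)}
  mul_mem' := by
    rintro m n ⟨h1, h2, h3⟩ ⟨k1, k2, k3⟩
    refine ⟨fun a b => ?_, fun a b => ?_, fun a b => ?_⟩
    · simp [h1, k1]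
    · simp [h2, k2]
    · simp [h3, k3]
  add_mem' := by
    rintro m n ⟨h1, h2, h3⟩ ⟨k1, k2, k3⟩
    refine ⟨fun a b => ?_, fun a b => ?_, fun a b => ?_⟩
    · simp [h1, k1, add_mul]
    · simp [h2, k2, mul_add]
    · simp [h3, k3, add_mul, mul_add]
  algebraMap_mem' := by
    intro r
    refine ⟨fun a b => ?_, fun a b => ?_, fun a b => ?_⟩ <;>
      simp [Algebra.algebraMap_eq_smul_one, smul_mul_assoc, mul_smul_comm]

/-- The multiplier algebra `M(A)`. -/
def MultiplierAlgebra : Type _ := multiplierSubalgebra A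

instance : Ring (MultiplierAlgebra A) := inferInstanceAs (Ring (multiplierSubalgebra A))

instance : Algebra ℂ (MultiplierAlgebra A) :=
  inferInstanceAs (Algebra ℂ (multiplierSubalgebra A))

instance : NonUnitalNonAssocSemiring (MultiplierAlgebra A) :=
  NonAssocSemiring.toNonUnitalNonAssocSemiring

instance : AddCommMonoid (MultiplierAlgebra A) :=
  NonUnitalNonAssocSemiring.toAddCommMonoid

instance : Module ℂ (MultiplierAlgebra A) := Algebra.toModule

instance : DistribMulAction ℂ (MultiplierAlgebra A) := Module.toDistribMulAction

end Multipliers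

section TensorInstances

variable {A : Type*} [NonUnitalRing A] [Module ℂ A] [SMulCommClass ℂ A A] [IsScalarTower ℂ A A]

instance : NonUnitalRing (A ⊗[ℂ] A) := Algebra.TensorProduct.instNonUnitalRing

instance : SMulCommClass ℂ (A ⊗[ℂ] A) (A ⊗[ℂ] A) := Algebra.TensorProduct.sMulCommClass_right

instance : IsScalarTower ℂ (A ⊗[ℂ] A) (A ⊗[ℂ] A) := Algebra.TensorProduct.isScalarTower_right

end TensorInstances

section MultiplierOps

variable {A : Type*} [NonUnitalRing A] [Module ℂ A] [SMulCommClass ℂ A A] [IsScalarTower ℂ A A]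

/-- `m.left a = m a`. -/
def MultiplierAlgebra.left (m : MultiplierAlgebra A) : A →ₗ[ℂ] A := m.1.1

/-- `m.right a = a m`. -/
def MultiplierAlgebra.right (m : MultiplierAlgebra A) : A →ₗ[ℂ] A := m.1.2.unop

theorem MultiplierAlgebra.ext' {m n : MultiplierAlgebra A} (h : m.left = n.left)
    (h' : m.right = n.right) : m = n :=
  Subtype.ext (Prod.ext h (MulOpposite.unop_injective h'))

@[simp] theorem MultiplierAlgebra.left_mul (m n : MultiplierAlgebra A) (a : A) :
    (m * n).left a = m.left (n.left a) := rfl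

@[simp] theorem MultiplierAlgebra.right_mul (m n : MultiplierAlgebra A) (a : A) :
    (m * n).right a = n.right (m.right a) := rfl

/-- The canonical map `A → M(A)`. -/
def ofElem : A →ₗ[ℂ] MultiplierAlgebra A where
  toFun a := ⟨(LinearMap.mulLeft ℂ a, MulOpposite.op (LinearMap.mulRight ℂ a)),
    fun b c => by simp [mul_assoc], fun b c => by simp [mul_assoc],
    fun b c => by simp [mul_assoc]⟩
  map_add' a b := MultiplierAlgebra.ext' (by ext x; exact add_mul a b x)
    (by ext x; exact mul_add x a b)
  map_smul' r a := MultiplierAlgebra.ext' (by ext x; exact smul_mul_assoc r a x)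
    (by ext x; exact mul_smul_comm r x a)

theorem ofElem_injective (h : Nondegenerate A) :
    Function.Injective (ofElem : A →ₗ[ℂ] MultiplierAlgebra A) := by
  rw [injective_iff_map_eq_zero]
  intro a ha
  exact h.1 a fun b => congrArg (fun m : MultiplierAlgebra A => m.left b) ha

@[simp] theorem ofElem_left (a x : A) : (ofElem a).left x = a * x := rfl

@[simp] theorem ofElem_right (a x : A) : (ofElem a).right x = x * a := rfl

theorem mul_ofElem (m : MultiplierAlgebra A) (a : A) : m * ofElem a = ofElem (m.left a) :=
  MultiplierAlgebra.ext' (by ext x; exact m.2.1 a x) (by ext x; exact m.2.2.2 x a)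

theorem ofElem_mul (m : MultiplierAlgebra A) (a : A) : ofElem a * m = ofElem (m.right a) :=
  MultiplierAlgebra.ext' (by ext x; exact (m.2.2.2 a x).symm) (by ext x; exact m.2.2.1 x a)

/-- The multiplier `a ⊗ 1` of `A ⊗ A`. -/
def leg₁ (a : A) : MultiplierAlgebra (A ⊗[ℂ] A) :=
  ⟨((LinearMap.mulLeft ℂ a).rTensor A, MulOpposite.op ((LinearMap.mulRight ℂ a).rTensor A)), by
    refine ⟨fun s t => ?_, fun s t => ?_, fun s t => ?_⟩ <;>
    induction s using TensorProduct.induction_on with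
    | zero => simp
    | add s s' hs hs' => simp_all [add_mul]
    | tmul x y =>
      induction t using TensorProduct.induction_on with
      | zero => simp
      | add t t' ht ht' => simp_all [mul_add]
      | tmul z w => simp [mul_assoc]⟩

/-- The multiplier `1 ⊗ a` of `A ⊗ A`. -/
def leg₂ (a : A) : MultiplierAlgebra (A ⊗[ℂ] A) :=
  ⟨((LinearMap.mulLeft ℂ a).lTensor A, MulOpposite.op ((LinearMap.mulRight ℂ a).lTensor A)), by
    refine ⟨fun s t => ?_, fun s t => ?_, fun s t => ?_⟩ <;>
    induction s using TensorProduct.induction_on with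
    | zero => simp
    | add s s' hs hs' => simp_all [add_mul]
    | tmul x y =>
      induction t using TensorProduct.induction_on with
      | zero => simp
      | add t t' ht ht' => simp_all [mul_add]
      | tmul z w => simp [mul_assoc]⟩

@[simp] theorem leg₁_left (a x y : A) : (leg₁ a).left (x ⊗ₜ[ℂ] y) = (a * x) ⊗ₜ y := rfl

@[simp] theorem leg₁_right (a x y : A) : (leg₁ a).right (x ⊗ₜ[ℂ] y) = (x * a) ⊗ₜ y := rfl

@[simp] theorem leg₂_left (a x y : A) : (leg₂ a).left (x ⊗ₜ[ℂ] y) = x ⊗ₜ (a * y) := rfl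

@[simp] theorem leg₂_right (a x y : A) : (leg₂ a).right (x ⊗ₜ[ℂ] y) = x ⊗ₜ (y * a) := rfl

/-- The flip map `x ⊗ y ↦ y ⊗ x` of `A ⊗ A`. -/
def swap : A ⊗[ℂ] A →ₗ[ℂ] A ⊗[ℂ] A := (TensorProduct.comm ℂ A A).toLinearMap

@[simp] theorem swap_tmul (x y : A) : swap (x ⊗ₜ[ℂ] y) = y ⊗ₜ x := rfl

@[simp] theorem swap_swap (t : A ⊗[ℂ] A) : swap (swap t) = t :=
  (TensorProduct.comm ℂ A A).symm_apply_apply t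

theorem swap_mul (s t : A ⊗[ℂ] A) : swap (s * t) = swap s * swap t := by
  induction s using TensorProduct.induction_on with
  | zero => simp
  | add s s' hs hs' => simp_all [add_mul]
  | tmul x y =>
    induction t using TensorProduct.induction_on with
    | zero => simp
    | add t t' ht ht' => simp_all [mul_add]
    | tmul z w => simp

/-- The extension of the flip map to `M(A ⊗ A)`. -/
def flipM : MultiplierAlgebra (A ⊗[ℂ] A) →ₙₐ[ℂ] MultiplierAlgebra (A ⊗[ℂ] A) where
  toFun m := ⟨(swap ∘ₗ m.left ∘ₗ swap, MulOpposite.op (swap ∘ₗ m.right ∘ₗ swap)), by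
    refine ⟨fun s t => ?_, fun s t => ?_, fun s t => ?_⟩
    · have := congrArg swap (m.2.1 (swap s) (swap t))
      rw [swap_mul _ (swap t), swap_swap, ← swap_mul s t] at this
      exact this
    · have := congrArg swap (m.2.2.1 (swap s) (swap t))
      rw [swap_mul (swap s) _, swap_swap, ← swap_mul s t] at this
      exact this
    · have := congrArg swap (m.2.2.2 (swap s) (swap t))
      rw [swap_mul, swap_mul, swap_swap, swap_swap] at this
      exact this⟩
  map_smul' r m := MultiplierAlgebra.ext' (LinearMap.ext fun t => map_smul swap r _)
    (LinearMap.ext fun t => map_smul swap r _)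
  map_zero' := MultiplierAlgebra.ext' (LinearMap.ext fun t => map_zero swap)
    (LinearMap.ext fun t => map_zero swap)
  map_add' m n := MultiplierAlgebra.ext' (LinearMap.ext fun t => map_add swap _ _)
    (LinearMap.ext fun t => map_add swap _ _)
  map_mul' m n := MultiplierAlgebra.ext'
    (LinearMap.ext fun t => by
      change swap (m.left (n.left (swap t))) = swap (m.left (swap (swap (n.left (swap t)))))
      rw [swap_swap])
    (LinearMap.ext fun t => by
      change swap (n.right (m.right (swap t))) = swap (n.right (swap (swap (m.right (swap t)))))
      rw [swap_swap])

end MultiplierOps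

section Structures

variable {A : Type*} [NonUnitalRing A] [Module ℂ A] [SMulCommClass ℂ A A] [IsScalarTower ℂ A A]

/-- `(A, Δ)` is a multiplier Hopf algebra: the product of `A` is non-degenerate; the elements
`Δ(a)(1 ⊗ b)` and `(a ⊗ 1)Δ(b)` of `M(A ⊗ A)` lie in `A ⊗ A`; the resulting maps
`T₁ : a ⊗ b ↦ Δ(a)(1 ⊗ b)` and `T₂ : a ⊗ b ↦ (a ⊗ 1)Δ(b)` are bijections of `A ⊗ A`;
and `Δ` is coassociative, i.e.
`(a ⊗ 1 ⊗ 1)(Δ ⊗ ι)(Δ(b)(1 ⊗ c)) = (ι ⊗ Δ)((a ⊗ 1)Δ(b))(1 ⊗ 1 ⊗ c)`. -/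
def IsMultiplierHopf (Δ : A →ₙₐ[ℂ] MultiplierAlgebra (A ⊗[ℂ] A)) : Prop :=
  Nondegenerate A ∧ ∃ T₁ T₂ : (A ⊗[ℂ] A) ≃ₗ[ℂ] (A ⊗[ℂ] A),
    (∀ a b, ofElem (T₁ (a ⊗ₜ b)) = Δ a * leg₂ b) ∧
    (∀ a b, ofElem (T₂ (a ⊗ₜ b)) = leg₁ a * Δ b) ∧
    ∀ a b c : A,
      TensorProduct.assoc ℂ A A A (T₂.toLinearMap.rTensor A
        ((TensorProduct.assoc ℂ A A A).symm (a ⊗ₜ T₁ (b ⊗ₜ c)))) =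
      T₁.toLinearMap.lTensor A (TensorProduct.assoc ℂ A A A (T₂ (a ⊗ₜ b) ⊗ₜ c))

/-- `(A, Δ)` is a regular multiplier Hopf algebra: both `Δ` and the flipped coproduct make `A`
into a multiplier Hopf algebra. -/
def IsRegularMultiplierHopf (Δ : A →ₙₐ[ℂ] MultiplierAlgebra (A ⊗[ℂ] A)) : Prop :=
  IsMultiplierHopf Δ ∧ IsMultiplierHopf (flipM.comp Δ)

end Structures

section Aux

variable {A : Type*} [NonUnitalRing A] [Module ℂ A] [SMulCommClass ℂ A A] [IsScalarTower ℂ A A]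

theorem rTensor_separates {M N P Q : Type*} [AddCommGroup M] [Module ℂ M] [AddCommGroup N]
    [Module ℂ N] [AddCommGroup P] [Module ℂ P] (f : Q → M →ₗ[ℂ] P)
    (hf : ∀ m, (∀ q, f q m = 0) → m = 0) (t : M ⊗[ℂ] N) (ht : ∀ q, (f q).rTensor N t = 0) :
    t = 0 := by
  classical
  let e := TensorProduct.equivFinsuppOfBasisRight (M := M) (Module.Free.chooseBasis ℂ N)
  let e' := TensorProduct.equivFinsuppOfBasisRight (M := P) (Module.Free.chooseBasis ℂ N)
  have key : ∀ q (t : M ⊗[ℂ] N) i, e' ((f q).rTensor N t) i = f q (e t i) := by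
    intro q t i
    induction t using TensorProduct.induction_on with
    | zero => simp
    | add s t hs ht => simp [hs, ht]
    | tmul x y => simp [e, e']
  apply e.injective
  rw [map_zero]
  ext i
  exact hf _ fun q => by rw [← key, ht]; simp

theorem mulLeft_add' (x y : A) :
    LinearMap.mulLeft ℂ (x + y) = LinearMap.mulLeft ℂ x + LinearMap.mulLeft ℂ y :=
  LinearMap.ext fun z => add_mul x y z

theorem mulLeft_smul' (r : ℂ) (x : A) :
    LinearMap.mulLeft ℂ (r • x) = r • LinearMap.mulLeft ℂ x :=
  LinearMap.ext fun z => smul_mul_assoc r x z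

theorem leg₁_right_swap (x : A) (t : A ⊗[ℂ] A) :
    (leg₁ x).right (swap t) = swap ((leg₂ x).right t) := by
  induction t using TensorProduct.induction_on with
  | zero => simp
  | add s t hs ht => simp only [map_add, hs, ht]
  | tmul y z => simp

theorem leg₁_left_swap (x : A) (t : A ⊗[ℂ] A) :
    (leg₁ x).left (swap t) = swap ((leg₂ x).left t) := by
  induction t using TensorProduct.induction_on with
  | zero => simp
  | add s t hs ht => simp only [map_add, hs, ht]
  | tmul y z => simp

theorem mul_tmul_eq (x y : A) (t : A ⊗[ℂ] A) :
    t * (x ⊗ₜ y) = (leg₁ x).right ((leg₂ y).right t) := by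
  induction t using TensorProduct.induction_on with
  | zero => simp
  | add s t hs ht => simp only [map_add, hs, ht, add_mul]
  | tmul y z => simp

theorem tmul_mul_eq (x y : A) (t : A ⊗[ℂ] A) :
    (x ⊗ₜ y) * t = (leg₁ x).left ((leg₂ y).left t) := by
  induction t using TensorProduct.induction_on with
  | zero => simp
  | add s t hs ht => simp only [map_add, hs, ht, mul_add]
  | tmul y z => simp

theorem leg₁_right_separates (h : Nondegenerate A) (t : A ⊗[ℂ] A)
    (ht : ∀ x, (leg₁ x).right t = 0) : t = 0 := by
  have h1 : ∀ x : A, (LinearMap.mulRight ℂ x).rTensor A t = 0 := ht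
  have h2 : ∀ m : A, (∀ x : A, LinearMap.mulRight ℂ x m = 0) → m = 0 := h.1
  exact rTensor_separates (fun x : A => LinearMap.mulRight ℂ x) h2 t h1

theorem leg₁_left_separates (h : Nondegenerate A) (t : A ⊗[ℂ] A)
    (ht : ∀ x, (leg₁ x).left t = 0) : t = 0 := by
  have h1 : ∀ x : A, (LinearMap.mulLeft ℂ x).rTensor A t = 0 := ht
  have h2 : ∀ m : A, (∀ x : A, LinearMap.mulLeft ℂ x m = 0) → m = 0 := h.2
  exact rTensor_separates (fun x : A => LinearMap.mulLeft ℂ x) h2 t h1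

theorem nondegenerate_tensor (h : Nondegenerate A) : Nondegenerate (A ⊗[ℂ] A) := by
  constructor
  · intro t ht
    have h0 : swap t = 0 := leg₁_right_separates h _ fun y => by
      have h1 : (leg₂ y).right t = 0 :=
        leg₁_right_separates h _ fun x => by rw [← mul_tmul_eq, ht]
      rw [leg₁_right_swap, h1, map_zero]
    rw [← swap_swap t, h0, map_zero]
  · intro t ht
    have h0 : swap t = 0 := leg₁_left_separates h _ fun y => by
      have h1 : (leg₂ y).left t = 0 :=
        leg₁_left_separates h _ fun x => by rw [← tmul_mul_eq, ht]
      rw [leg₁_left_swap, h1, map_zero]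
    rw [← swap_swap t, h0, map_zero]

theorem leg₁_mul (x y : A) : leg₁ (x * y) = leg₁ x * leg₁ y := by
  apply MultiplierAlgebra.ext' <;> refine TensorProduct.ext' fun p q => ?_
  · change (x * y * p) ⊗ₜ[ℂ] q = (x * (y * p)) ⊗ₜ q
    rw [mul_assoc]
  · change (p * (x * y)) ⊗ₜ[ℂ] q = ((p * x) * y) ⊗ₜ q
    rw [mul_assoc]

theorem leg₁_mul_leg₂ (x y : A) : leg₁ x * leg₂ y = ofElem (x ⊗ₜ[ℂ] y) := by
  apply MultiplierAlgebra.ext' <;> exact TensorProduct.ext' fun p q => by simp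

theorem leg₂_mul_leg₁ (x y : A) : leg₂ y * leg₁ x = ofElem (x ⊗ₜ[ℂ] y) := by
  apply MultiplierAlgebra.ext' <;> exact TensorProduct.ext' fun p q => by simp

theorem flipM_flipM (m : MultiplierAlgebra (A ⊗[ℂ] A)) : flipM (flipM m) = m := by
  apply MultiplierAlgebra.ext' <;> refine LinearMap.ext fun t => ?_
  · change swap (swap (m.left (swap (swap t)))) = _
    simp
  · change swap (swap (m.right (swap (swap t)))) = _
    simp

theorem flipM_leg₂ (x : A) : flipM (leg₂ x) = leg₁ x := by
  apply MultiplierAlgebra.ext' <;> exact TensorProduct.ext' fun p q => rfl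

theorem flipM_ofElem (t : A ⊗[ℂ] A) : flipM (ofElem t) = ofElem (swap t) := by
  apply MultiplierAlgebra.ext' <;> refine LinearMap.ext fun s => ?_
  · change swap (t * swap s) = swap t * s
    rw [swap_mul, swap_swap]
  · change swap (swap s * t) = s * swap t
    rw [swap_mul, swap_swap]

/-- The slice map `ι ⊗ ω : A ⊗ A → A`, bilinear in `ω` and the tensor. -/
def sl : Module.Dual ℂ A →ₗ[ℂ] A ⊗[ℂ] A →ₗ[ℂ] A :=
  (LinearMap.llcomp ℂ (A ⊗[ℂ] A) (A ⊗[ℂ] ℂ) A (TensorProduct.rid ℂ A).toLinearMap) ∘ₗ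
    LinearMap.lTensorHom A

@[simp] theorem sl_tmul (ω : Module.Dual ℂ A) (x y : A) : sl ω (x ⊗ₜ y) = ω y • x := by
  simp [sl]

theorem sl_leg₁_right (ω : Module.Dual ℂ A) (c : A) (t : A ⊗[ℂ] A) :
    sl ω ((leg₁ c).right t) = sl ω t * c := by
  induction t using TensorProduct.induction_on with
  | zero => simp
  | add s t hs ht => simp [hs, ht, add_mul]
  | tmul x y =>
    change sl ω ((x * c) ⊗ₜ y) = _
    simp [smul_mul_assoc]

theorem sl_leg₁_left (ω : Module.Dual ℂ A) (c : A) (t : A ⊗[ℂ] A) :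
    sl ω ((leg₁ c).left t) = c * sl ω t := by
  induction t using TensorProduct.induction_on with
  | zero => simp
  | add s t hs ht => simp [hs, ht, mul_add]
  | tmul x y =>
    change sl ω ((c * x) ⊗ₜ y) = _
    simp [mul_smul_comm]

/-- The functional `φ( · c)`. -/
def shift (φ : Module.Dual ℂ A) : A →ₗ[ℂ] Module.Dual ℂ A :=
  (LinearMap.mul ℂ A).flip.compr₂ φ

@[simp] theorem shift_apply (φ : Module.Dual ℂ A) (c a : A) : shift φ c a = φ (a * c) := rfl

theorem sl_shift (φ : Module.Dual ℂ A) (c : A) (t : A ⊗[ℂ] A) :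
    sl (shift φ c) t = sl φ ((leg₂ c).right t) := by
  induction t using TensorProduct.induction_on with
  | zero => simp
  | add s t hs ht => simp [hs, ht]
  | tmul x y =>
    change _ = sl φ (x ⊗ₜ (y * c))
    simp

end Aux

namespace IsRegularMultiplierHopf

variable {A : Type*} [NonUnitalRing A] [Module ℂ A] [SMulCommClass ℂ A A] [IsScalarTower ℂ A A]
variable {Δ : A →ₙₐ[ℂ] MultiplierAlgebra (A ⊗[ℂ] A)}

/-- `T₁ (a ⊗ b) = Δ(a)(1 ⊗ b)`. -/
def T₁ (h : IsRegularMultiplierHopf Δ) : (A ⊗[ℂ] A) ≃ₗ[ℂ] (A ⊗[ℂ] A) := h.1.2.choose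

/-- `T₂ (a ⊗ b) = (a ⊗ 1)Δ(b)`. -/
def T₂ (h : IsRegularMultiplierHopf Δ) : (A ⊗[ℂ] A) ≃ₗ[ℂ] (A ⊗[ℂ] A) :=
  h.1.2.choose_spec.choose

/-- `T₃ (a ⊗ b) = Δ(a)(b ⊗ 1)`. -/
def T₃ (h : IsRegularMultiplierHopf Δ) : (A ⊗[ℂ] A) ≃ₗ[ℂ] (A ⊗[ℂ] A) :=
  h.2.2.choose.trans (TensorProduct.comm ℂ A A)

theorem T₁_spec (h : IsRegularMultiplierHopf Δ) (a b : A) :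
    ofElem (h.T₁ (a ⊗ₜ b)) = Δ a * leg₂ b := h.1.2.choose_spec.choose_spec.1 a b

theorem T₂_spec (h : IsRegularMultiplierHopf Δ) (a b : A) :
    ofElem (h.T₂ (a ⊗ₜ b)) = leg₁ a * Δ b := h.1.2.choose_spec.choose_spec.2.1 a b

theorem coassoc (h : IsRegularMultiplierHopf Δ) (a b c : A) :
    TensorProduct.assoc ℂ A A A (h.T₂.toLinearMap.rTensor A
      ((TensorProduct.assoc ℂ A A A).symm (a ⊗ₜ h.T₁ (b ⊗ₜ c)))) =
    h.T₁.toLinearMap.lTensor A (TensorProduct.assoc ℂ A A A (h.T₂ (a ⊗ₜ b) ⊗ₜ c)) :=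
  h.1.2.choose_spec.choose_spec.2.2 a b c

theorem T₃_spec (h : IsRegularMultiplierHopf Δ) (a b : A) :
    ofElem (h.T₃ (a ⊗ₜ b)) = Δ a * leg₁ b := by
  have h1 := h.2.2.choose_spec.choose_spec.1 a b
  have h2 := congrArg flipM h1
  rw [flipM_ofElem, map_mul, flipM_leg₂, NonUnitalAlgHom.comp_apply, flipM_flipM] at h2
  exact h2

theorem inj (h : IsRegularMultiplierHopf Δ) :
    Function.Injective (ofElem : A ⊗[ℂ] A →ₗ[ℂ] MultiplierAlgebra (A ⊗[ℂ] A)) :=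
  ofElem_injective (nondegenerate_tensor h.1.1)

/-- The multiplier `(ι ⊗ ω)Δ(a)` of `A`, for a linear functional `ω` on `A` and `a ∈ A`:
`((ι ⊗ ω)Δ(a)) x = (ι ⊗ ω)(Δ(a)(x ⊗ 1))` and `x ((ι ⊗ ω)Δ(a)) = (ι ⊗ ω)((x ⊗ 1)Δ(a))`. -/
def slice (h : IsRegularMultiplierHopf Δ) :
    Module.Dual ℂ A →ₗ[ℂ] A →ₗ[ℂ] MultiplierAlgebra A :=
  LinearMap.mk₂ ℂ
    (fun ω a => ⟨(sl ω ∘ₗ h.T₃.toLinearMap ∘ₗ TensorProduct.mk ℂ A A a,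
        MulOpposite.op (sl ω ∘ₗ h.T₂.toLinearMap ∘ₗ (TensorProduct.mk ℂ A A).flip a)), by
      refine ⟨fun x y => ?_, fun x y => ?_, fun x y => ?_⟩
      · change sl ω (h.T₃ (a ⊗ₜ (x * y))) = sl ω (h.T₃ (a ⊗ₜ x)) * y
        rw [← sl_leg₁_right]
        congr 1
        apply h.inj
        rw [← ofElem_mul, T₃_spec, T₃_spec, leg₁_mul, mul_assoc]
      · change sl ω (h.T₂ ((x * y) ⊗ₜ a)) = x * sl ω (h.T₂ (y ⊗ₜ a))
        rw [← sl_leg₁_left]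
        congr 1
        apply h.inj
        rw [← mul_ofElem, T₂_spec, T₂_spec, leg₁_mul, mul_assoc]
      · change sl ω (h.T₂ (x ⊗ₜ a)) * y = x * sl ω (h.T₃ (a ⊗ₜ y))
        rw [← sl_leg₁_left, ← sl_leg₁_right]
        congr 1
        apply h.inj
        rw [← mul_ofElem, ← ofElem_mul, T₂_spec, T₃_spec, mul_assoc]⟩)
    (fun ω ω' a => MultiplierAlgebra.ext'
      (LinearMap.ext fun x => by
        change sl (ω + ω') (h.T₃ (a ⊗ₜ x)) = sl ω (h.T₃ (a ⊗ₜ x)) + sl ω' (h.T₃ (a ⊗ₜ x))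
        rw [map_add, LinearMap.add_apply])
      (LinearMap.ext fun x => by
        change sl (ω + ω') (h.T₂ (x ⊗ₜ a)) = sl ω (h.T₂ (x ⊗ₜ a)) + sl ω' (h.T₂ (x ⊗ₜ a))
        rw [map_add, LinearMap.add_apply]))
    (fun r ω a => MultiplierAlgebra.ext'
      (LinearMap.ext fun x => by
        change sl (r • ω) (h.T₃ (a ⊗ₜ x)) = r • sl ω (h.T₃ (a ⊗ₜ x))
        rw [map_smul, LinearMap.smul_apply])
      (LinearMap.ext fun x => by
        change sl (r • ω) (h.T₂ (x ⊗ₜ a)) = r • sl ω (h.T₂ (x ⊗ₜ a))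
        rw [map_smul, LinearMap.smul_apply]))
    (fun ω a a' => MultiplierAlgebra.ext'
      (LinearMap.ext fun x => by
        change sl ω (h.T₃ ((a + a') ⊗ₜ x)) = sl ω (h.T₃ (a ⊗ₜ x)) + sl ω (h.T₃ (a' ⊗ₜ x))
        rw [TensorProduct.add_tmul, map_add, map_add])
      (LinearMap.ext fun x => by
        change sl ω (h.T₂ (x ⊗ₜ (a + a'))) = sl ω (h.T₂ (x ⊗ₜ a)) + sl ω (h.T₂ (x ⊗ₜ a'))
        rw [TensorProduct.tmul_add, map_add, map_add]))
    (fun r ω a => MultiplierAlgebra.ext'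
      (LinearMap.ext fun x => by
        change sl ω (h.T₃ ((r • a) ⊗ₜ x)) = r • sl ω (h.T₃ (a ⊗ₜ x))
        rw [← TensorProduct.smul_tmul', map_smul, map_smul])
      (LinearMap.ext fun x => by
        change sl ω (h.T₂ (x ⊗ₜ (r • a))) = r • sl ω (h.T₂ (x ⊗ₜ a))
        rw [TensorProduct.tmul_smul, map_smul, map_smul]))

theorem slice_left (h : IsRegularMultiplierHopf Δ) (ω : Module.Dual ℂ A) (a x : A) :
    (h.slice ω a).left x = sl ω (h.T₃ (a ⊗ₜ x)) := rfl

theorem slice_right (h : IsRegularMultiplierHopf Δ) (ω : Module.Dual ℂ A) (a x : A) :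
    (h.slice ω a).right x = sl ω (h.T₂ (x ⊗ₜ a)) := rfl

/-- `(ι ⊗ φ( · c))Δ(a)` is the element `(ι ⊗ φ)(Δ(a)(1 ⊗ c))` of `A`. -/
theorem slice_shift (h : IsRegularMultiplierHopf Δ) (φ : Module.Dual ℂ A) (c a : A) :
    ofElem (sl φ (h.T₁ (a ⊗ₜ c))) = h.slice (shift φ c) a := by
  apply MultiplierAlgebra.ext' <;> refine LinearMap.ext fun x => ?_
  · rw [slice_left, sl_shift, ofElem_left, ← sl_leg₁_right]
    congr 1
    apply h.inj
    rw [← ofElem_mul, ← ofElem_mul, T₁_spec, T₃_spec, mul_assoc, mul_assoc, leg₁_mul_leg₂,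
      leg₂_mul_leg₁]
  · rw [slice_right, sl_shift, ofElem_right, ← sl_leg₁_left]
    congr 1
    apply h.inj
    rw [← mul_ofElem, ← ofElem_mul, T₁_spec, T₂_spec, mul_assoc]

end IsRegularMultiplierHopf

/-- An algebraic quantum group, with a chosen left integral `φ`: a regular multiplier Hopf
algebra `(A, Δ)` together with a non-zero linear functional `φ` such that
`(ι ⊗ φ)Δ(a) = φ(a) 1` in `M(A)` for all `a`. -/
structure AlgebraicQuantumGroup (A : Type*) [NonUnitalRing A] [Module ℂ A]
    [SMulCommClass ℂ A A] [IsScalarTower ℂ A A] where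
  Δ : A →ₙₐ[ℂ] MultiplierAlgebra (A ⊗[ℂ] A)
  regular : IsRegularMultiplierHopf Δ
  φ : Module.Dual ℂ A
  φ_ne_zero : φ ≠ 0
  left_invariant : ∀ a, regular.slice φ a = φ a • (1 : MultiplierAlgebra A)

namespace AlgebraicQuantumGroup

variable {A : Type*} [NonUnitalRing A] [Module ℂ A] [SMulCommClass ℂ A A] [IsScalarTower ℂ A A]
variable (G : AlgebraicQuantumGroup A)

/-- The underlying space of the dual: the functionals `φ( · c)` with `c ∈ A`. -/
def Dual : Type _ := LinearMap.range (shift G.φ)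

instance : AddCommGroup G.Dual := inferInstanceAs (AddCommGroup (LinearMap.range (shift G.φ)))

instance : Module ℂ G.Dual := inferInstanceAs (Module ℂ (LinearMap.range (shift G.φ)))

/-- An element of the dual, as a functional on `A`. -/
def toFunctional : G.Dual →ₗ[ℂ] Module.Dual ℂ A := (LinearMap.range (shift G.φ)).subtype

theorem toFunctional_injective : Function.Injective G.toFunctional :=
  (LinearMap.range (shift G.φ)).subtype_injective

/-- The functional `φ( · c)`, as an element of the dual. -/
def hat : A →ₗ[ℂ] G.Dual := (shift G.φ).rangeRestrict

theorem hat_surjective : Function.Surjective G.hat := (shift G.φ).surjective_rangeRestrict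

@[simp] theorem toFunctional_hat (c : A) : G.toFunctional (G.hat c) = shift G.φ c := rfl

/-- The pairing `⟨a, b⟩` of `A` with its dual, by evaluation. -/
def pairing : A →ₗ[ℂ] G.Dual →ₗ[ℂ] ℂ := G.toFunctional.flip

theorem pairing_hat (a c : A) : G.pairing a (G.hat c) = G.φ (a * c) := rfl

theorem slice_mem (b : G.Dual) (a : A) :
    ∃ y : A, ofElem y = G.regular.slice (G.toFunctional b) a := by
  obtain ⟨c, rfl⟩ := G.hat_surjective b
  exact ⟨_, G.regular.slice_shift G.φ c a⟩

theorem emb_injective (G : AlgebraicQuantumGroup A) : Function.Injective (ofElem : A →ₗ[ℂ] MultiplierAlgebra A) :=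
  ofElem_injective G.regular.1.1

/-- The element `b ▷ a = (ι ⊗ ⟨ · , b⟩)Δ(a)` of `M(A)`, which lies in `A`. -/
def actFun (b : G.Dual) (a : A) : A := (G.slice_mem b a).choose

theorem ofElem_actFun (b : G.Dual) (a : A) :
    ofElem (G.actFun b a) = G.regular.slice (G.toFunctional b) a := (G.slice_mem b a).choose_spec

/-- The left action `b ▷ a = (ι ⊗ ⟨ · , b⟩)Δ(a)` of the dual on `A`. -/
def act : G.Dual →ₗ[ℂ] A →ₗ[ℂ] A :=
  LinearMap.mk₂ ℂ G.actFun
    (fun b b' a => G.emb_injective (by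
      simp only [ofElem_actFun, map_add, LinearMap.add_apply]))
    (fun r b a => G.emb_injective (by
      simp only [ofElem_actFun, map_smul, LinearMap.smul_apply]))
    (fun b a a' => G.emb_injective (by simp only [ofElem_actFun, map_add]))
    (fun r b a => G.emb_injective (by simp only [ofElem_actFun, map_smul]))

theorem ofElem_act (b : G.Dual) (a : A) :
    ofElem (G.act b a) = G.regular.slice (G.toFunctional b) a := G.ofElem_actFun b a

theorem mul_act (b : G.Dual) (a x : A) :
    x * G.act b a = sl (G.toFunctional b) (G.regular.T₂ (x ⊗ₜ a)) :=
  congrArg (fun m : MultiplierAlgebra A => m.right x) (G.ofElem_act b a)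

theorem act_hat (c a : A) : G.act (G.hat c) a = sl G.φ (G.regular.T₁ (a ⊗ₜ c)) :=
  G.emb_injective ((G.ofElem_act _ _).trans (G.regular.slice_shift G.φ c a).symm)

theorem sl_T₃ (p q : A) : sl G.φ (G.regular.T₃ (p ⊗ₜ q)) = G.φ p • q :=
  congrArg (fun m : MultiplierAlgebra A => m.left q) (G.left_invariant p)

theorem left_T₃ (a p q : A) :
    (G.Δ a).left (G.regular.T₃ (p ⊗ₜ q)) = G.regular.T₃ ((a * p) ⊗ₜ q) := by
  apply G.regular.inj
  rw [← mul_ofElem, IsRegularMultiplierHopf.T₃_spec, IsRegularMultiplierHopf.T₃_spec,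
    map_mul, mul_assoc]

/-- `(b' ▷ a) c = (ι ⊗ φ)(Δ(a)(c ⊗ c'))` for `b' = φ( · c')`. -/
theorem act_hat_mul (a c c' : A) :
    G.act (G.hat c') a * c = sl G.φ ((G.Δ a).left (c ⊗ₜ c')) := by
  rw [act_hat, ← sl_leg₁_right]
  congr 1
  apply G.regular.inj
  rw [← ofElem_mul, IsRegularMultiplierHopf.T₁_spec, ← mul_ofElem, mul_assoc, leg₂_mul_leg₁]

theorem mul_mem (b b' : G.Dual) :
    ∃ d : G.Dual, G.toFunctional d = G.toFunctional b ∘ₗ G.act b' := by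
  obtain ⟨c, rfl⟩ := G.hat_surjective b
  obtain ⟨c', rfl⟩ := G.hat_surjective b'
  suffices H : ∀ t : A ⊗[ℂ] A, ∃ d : G.Dual, ∀ a, G.toFunctional d a =
      G.φ (sl G.φ ((G.Δ a).left t)) by
    obtain ⟨d, hd⟩ := H (c ⊗ₜ c')
    refine ⟨d, LinearMap.ext fun a => ?_⟩
    rw [hd, ← act_hat_mul]
    rfl
  intro t
  obtain ⟨s, rfl⟩ := G.regular.T₃.surjective t
  induction s using TensorProduct.induction_on with
  | zero => exact ⟨0, fun a => by simp⟩
  | add s s' hs hs' =>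
    obtain ⟨d, hd⟩ := hs
    obtain ⟨d', hd'⟩ := hs'
    exact ⟨d + d', fun a => by simp only [map_add, LinearMap.add_apply, hd, hd']⟩
  | tmul p q =>
    refine ⟨G.φ q • G.hat p, fun a => ?_⟩
    rw [left_T₃, sl_T₃]
    simp [mul_comm]

/-- The product `b b'` of the dual: the functional `a ↦ ⟨Δ(a), b ⊗ b'⟩ = ⟨b' ▷ a, b⟩`, where
`b' ▷ a = (ι ⊗ ⟨ · , b'⟩)Δ(a)`. -/
def mulFun (b b' : G.Dual) : G.Dual := (G.mul_mem b b').choose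

theorem toFunctional_mulFun (b b' : G.Dual) :
    G.toFunctional (G.mulFun b b') = G.toFunctional b ∘ₗ G.act b' := (G.mul_mem b b').choose_spec

/-- The product of the dual as a bilinear map. -/
def dualMul : G.Dual →ₗ[ℂ] G.Dual →ₗ[ℂ] G.Dual :=
  LinearMap.mk₂ ℂ G.mulFun
    (fun b b' d => G.toFunctional_injective (by
      simp only [toFunctional_mulFun, map_add, LinearMap.add_comp]))
    (fun r b d => G.toFunctional_injective (by
      simp only [toFunctional_mulFun, map_smul, LinearMap.smul_comp]))
    (fun b d d' => G.toFunctional_injective (by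
      simp only [toFunctional_mulFun, map_add, LinearMap.comp_add]))
    (fun r b d => G.toFunctional_injective (by
      simp only [toFunctional_mulFun, map_smul, LinearMap.comp_smul]))

instance : Mul G.Dual := ⟨fun b b' => G.dualMul b b'⟩

theorem toFunctional_mul (b b' : G.Dual) :
    G.toFunctional (b * b') = G.toFunctional b ∘ₗ G.act b' := G.toFunctional_mulFun b b'

theorem pairing_mul (a : A) (b b' : G.Dual) :
    G.pairing a (b * b') = G.pairing (G.act b' a) b :=
  LinearMap.congr_fun (G.toFunctional_mul b b') a

theorem sl_comp_act (ω : Module.Dual ℂ A) (b : G.Dual) (c : A) (hb : b = G.hat c) (t : A ⊗[ℂ] A) :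
    sl (ω ∘ₗ G.act b) t = sl ω ((sl G.φ).lTensor A
      (G.regular.T₁.toLinearMap.lTensor A (TensorProduct.assoc ℂ A A A (t ⊗ₜ c)))) := by
  induction t using TensorProduct.induction_on with
  | zero => simp
  | add s t hs ht => simp only [map_add, TensorProduct.add_tmul, hs, ht]
  | tmul x y => subst hb; simp [act_hat]

theorem T₂_sl (x : A) (t : A ⊗[ℂ] A) :
    G.regular.T₂ (x ⊗ₜ sl G.φ t) = (sl G.φ).lTensor A (TensorProduct.assoc ℂ A A A
      (G.regular.T₂.toLinearMap.rTensor A ((TensorProduct.assoc ℂ A A A).symm (x ⊗ₜ t)))) := by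
  have key : ∀ (s : A ⊗[ℂ] A) (z : A), (sl G.φ).lTensor A
      (TensorProduct.assoc ℂ A A A (s ⊗ₜ z)) = G.φ z • s := by
    intro s z
    induction s using TensorProduct.induction_on with
    | zero => simp
    | add s t hs ht => simp only [map_add, TensorProduct.add_tmul, hs, ht, smul_add]
    | tmul x y => simp [TensorProduct.tmul_smul]
  induction t using TensorProduct.induction_on with
  | zero => simp
  | add s t hs ht => simp only [map_add, TensorProduct.tmul_add, hs, ht]
  | tmul y z => simp [key, TensorProduct.tmul_smul]

/-- `A` is a left module over the dual. -/
theorem mul_act_apply (b b' : G.Dual) (a : A) : G.act (b * b') a = G.act b (G.act b' a) := by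
  obtain ⟨c', hc⟩ := G.hat_surjective b'
  have : ∀ x, x * (G.act (b * b') a - G.act b (G.act b' a)) = 0 := by
    intro x
    rw [mul_sub, mul_act, mul_act, toFunctional_mul, G.sl_comp_act _ b' c' hc.symm,
      ← G.regular.coassoc, ← T₂_sl, ← act_hat, hc, sub_self]
  exact sub_eq_zero.1 (G.regular.1.1.2 _ this)

instance : NonUnitalRing G.Dual where
  left_distrib b c d := map_add (G.dualMul b) c d
  right_distrib b c d := LinearMap.congr_fun (map_add G.dualMul b c) d
  zero_mul b := LinearMap.congr_fun (map_zero G.dualMul) b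
  mul_zero b := map_zero (G.dualMul b)
  mul_assoc b c d := G.toFunctional_injective (LinearMap.ext fun a => by
    rw [toFunctional_mul, toFunctional_mul, toFunctional_mul]
    simp only [LinearMap.comp_apply, mul_act_apply])

/-- The pairing of `A ⊗ A` with `Â ⊗ Â`, as a map from `Â ⊗ Â` to the functionals on `A ⊗ A`. -/
def pairing₂ : G.Dual ⊗[ℂ] G.Dual →ₗ[ℂ] Module.Dual ℂ (A ⊗[ℂ] A) :=
  TensorProduct.dualDistrib ℂ A A ∘ₗ TensorProduct.map G.toFunctional G.toFunctional

@[simp] theorem pairing₂_tmul (b b' : G.Dual) (a a' : A) :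
    G.pairing₂ (b ⊗ₜ b') (a ⊗ₜ a') = G.pairing a b * G.pairing a' b' := rfl

theorem pairing₂_injective : Function.Injective G.pairing₂ := by
  rw [injective_iff_map_eq_zero]
  intro t ht
  have key : ∀ (t : G.Dual ⊗[ℂ] G.Dual) (a a' : A), G.pairing₂ t (a ⊗ₜ a') =
      G.pairing a' (TensorProduct.lid ℂ G.Dual ((G.pairing a).rTensor G.Dual t)) := by
    intro t a a'
    induction t using TensorProduct.induction_on with
    | zero => simp
    | add s t hs ht => simp only [map_add, LinearMap.add_apply, hs, ht]
    | tmul b b' => simp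
  refine rTensor_separates (fun a => G.pairing a) (fun b hb =>
    G.toFunctional_injective (LinearMap.ext hb)) t fun a => ?_
  apply (TensorProduct.lid ℂ G.Dual).injective
  rw [map_zero]
  refine G.toFunctional_injective (LinearMap.ext fun a' => ?_)
  exact (key t a a').symm.trans (by rw [ht]; rfl)

/-- For `b, b'` in the dual, the functional `a ⊗ a' ↦ ⟨a (b' ▷ a'), b⟩ = ⟨a ⊗ (b' ▷ a'), Δ(b)⟩`
on `A ⊗ A`; this is the pairing with `Δ(b)(1 ⊗ b')`. -/
def coprodFunctional : G.Dual ⊗[ℂ] G.Dual →ₗ[ℂ] Module.Dual ℂ (A ⊗[ℂ] A) :=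
  TensorProduct.lift (LinearMap.mk₂ ℂ
    (fun b b' => G.toFunctional b ∘ₗ TensorProduct.lift ((LinearMap.mul ℂ A).compl₂ (G.act b')))
    (fun b b' d => by rw [map_add, LinearMap.add_comp])
    (fun r b d => by rw [map_smul, LinearMap.smul_comp])
    (fun b d d' => TensorProduct.ext' fun x y => by simp [mul_add])
    (fun r b d => TensorProduct.ext' fun x y => by simp))

@[simp] theorem coprodFunctional_tmul (b b' : G.Dual) (a a' : A) :
    G.coprodFunctional (b ⊗ₜ b') (a ⊗ₜ a') = G.pairing (a * G.act b' a') b := rfl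

theorem coprod_mem (t : G.Dual ⊗[ℂ] G.Dual) : ∃ s, G.pairing₂ s = G.coprodFunctional t := by
  induction t using TensorProduct.induction_on with
  | zero => exact ⟨0, by simp⟩
  | add s t hs ht =>
    obtain ⟨d, hd⟩ := hs
    obtain ⟨d', hd'⟩ := ht
    exact ⟨d + d', by simp only [map_add, hd, hd']⟩
  | tmul b b' =>
    obtain ⟨c, rfl⟩ := G.hat_surjective b
    obtain ⟨c', rfl⟩ := G.hat_surjective b'
    suffices H : ∀ t : A ⊗[ℂ] A, ∃ d, ∀ a a', G.pairing₂ d (a ⊗ₜ a') =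
        G.φ (a * sl G.φ ((G.Δ a').left t)) by
      obtain ⟨d, hd⟩ := H (c ⊗ₜ c')
      refine ⟨d, TensorProduct.ext' fun a a' => ?_⟩
      rw [hd, ← act_hat_mul, coprodFunctional_tmul, pairing_hat, mul_assoc]
    intro t
    obtain ⟨s, rfl⟩ := G.regular.T₃.surjective t
    induction s using TensorProduct.induction_on with
    | zero => exact ⟨0, fun a => by simp⟩
    | add s s' hs hs' =>
      obtain ⟨d, hd⟩ := hs
      obtain ⟨d', hd'⟩ := hs'
      exact ⟨d + d', fun a a' => by simp only [map_add, LinearMap.add_apply, mul_add, hd, hd']⟩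
    | tmul p q =>
      refine ⟨G.hat q ⊗ₜ G.hat p, fun a a' => ?_⟩
      rw [left_T₃, sl_T₃, pairing₂_tmul, pairing_hat, pairing_hat, mul_smul_comm, map_smul,
        smul_eq_mul, mul_comm]

/-- The coproduct of the dual, in the form of the map `b ⊗ b' ↦ Δ(b)(1 ⊗ b')` of `Â ⊗ Â` into
itself, characterized by `⟨a ⊗ a', Δ(b)(1 ⊗ b')⟩ = ⟨a ⊗ (b' ▷ a'), Δ(b)⟩ = ⟨a (b' ▷ a'), b⟩`. -/
def dualT₁ : G.Dual ⊗[ℂ] G.Dual →ₗ[ℂ] G.Dual ⊗[ℂ] G.Dual :=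
  (LinearEquiv.ofInjective G.pairing₂ G.pairing₂_injective).symm.toLinearMap ∘ₗ
    LinearMap.codRestrict _ G.coprodFunctional fun t => G.coprod_mem t

theorem pairing₂_dualT₁ (t : G.Dual ⊗[ℂ] G.Dual) :
    G.pairing₂ (G.dualT₁ t) = G.coprodFunctional t :=
  congrArg Subtype.val
    ((LinearEquiv.ofInjective G.pairing₂ G.pairing₂_injective).apply_symm_apply
      (LinearMap.codRestrict _ G.coprodFunctional (fun t => G.coprod_mem t) t))

/-- The underlying space `A ⊗ Â` of the Heisenberg algebra. -/
def Heisenberg : Type _ := A ⊗[ℂ] G.Dual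

instance : AddCommGroup G.Heisenberg := inferInstanceAs (AddCommGroup (A ⊗[ℂ] G.Dual))

instance : Module ℂ G.Heisenberg := inferInstanceAs (Module ℂ (A ⊗[ℂ] G.Dual))

/-- The element `a ⊗ b` of the Heisenberg algebra. -/
def Heisenberg.tmul : A →ₗ[ℂ] G.Dual →ₗ[ℂ] G.Heisenberg := TensorProduct.mk ℂ A G.Dual

/-- The map `p ⊗ q ↦ a (p ▷ a') ⊗ q` from `Â ⊗ Â` to `A ⊗ Â`. -/
def heisenbergTwist (a a' : A) : G.Dual ⊗[ℂ] G.Dual →ₗ[ℂ] A ⊗[ℂ] G.Dual :=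
  (LinearMap.mulLeft ℂ a ∘ₗ G.act.flip a').rTensor G.Dual

@[simp] theorem heisenbergTwist_tmul (a a' : A) (p q : G.Dual) :
    G.heisenbergTwist a a' (p ⊗ₜ q) = (a * G.act p a') ⊗ₜ q := rfl

/-- Left multiplication by `a ⊗ b` in the Heisenberg algebra,
`(a ⊗ b)(a' ⊗ b') = ∑ ⟨a'₍₂₎, b₍₁₎⟩ a a'₍₁₎ ⊗ b₍₂₎ b'`.  In other words the product is
`∑ᵢ a (pᵢ ▷ a') ⊗ qᵢ` where `∑ᵢ pᵢ ⊗ qᵢ = Δ(b)(1 ⊗ b')`. -/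
def heisenbergMulLeft (a : A) (b : G.Dual) : A ⊗[ℂ] G.Dual →ₗ[ℂ] A ⊗[ℂ] G.Dual :=
  TensorProduct.lift (LinearMap.mk₂ ℂ
    (fun (a' : A) (b' : G.Dual) => G.heisenbergTwist a a' (G.dualT₁ (b ⊗ₜ b')))
    (fun x y d => by simp [heisenbergTwist, LinearMap.comp_add, LinearMap.rTensor_add])
    (fun r x d => by simp [heisenbergTwist, LinearMap.comp_smul, LinearMap.rTensor_smul])
    (fun x d d' => by simp [TensorProduct.tmul_add])
    (fun r x d => by simp))

theorem heisenbergMulLeft_tmul (a a' : A) (b b' : G.Dual) :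
    G.heisenbergMulLeft a b (a' ⊗ₜ b') = G.heisenbergTwist a a' (G.dualT₁ (b ⊗ₜ b')) := rfl

/-- The product of the Heisenberg algebra, as a bilinear map. -/
def heisenbergMul : A ⊗[ℂ] G.Dual →ₗ[ℂ] A ⊗[ℂ] G.Dual →ₗ[ℂ] A ⊗[ℂ] G.Dual :=
  TensorProduct.lift (LinearMap.mk₂ ℂ G.heisenbergMulLeft
    (fun x y d => TensorProduct.ext' fun a b => by
      simp only [LinearMap.add_apply, heisenbergMulLeft_tmul, heisenbergTwist, mulLeft_add',
        LinearMap.add_comp, LinearMap.rTensor_add])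
    (fun r x d => TensorProduct.ext' fun a b => by
      simp only [LinearMap.smul_apply, heisenbergMulLeft_tmul, heisenbergTwist, mulLeft_smul',
        LinearMap.smul_comp, LinearMap.rTensor_smul])
    (fun x d d' => TensorProduct.ext' fun a b => by
      simp only [LinearMap.add_apply, heisenbergMulLeft_tmul, TensorProduct.add_tmul, map_add])
    (fun r x d => TensorProduct.ext' fun a b => by
      simp only [LinearMap.smul_apply, heisenbergMulLeft_tmul, ← TensorProduct.smul_tmul',
        map_smul]))

instance : Mul G.Heisenberg := ⟨fun u v => (G.heisenbergMul u v : A ⊗[ℂ] G.Dual)⟩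

instance : NonUnitalNonAssocRing G.Heisenberg where
  left_distrib u v w := map_add (G.heisenbergMul u) v w
  right_distrib u v w := LinearMap.congr_fun (map_add G.heisenbergMul u v) w
  zero_mul u := LinearMap.congr_fun (map_zero G.heisenbergMul) u
  mul_zero u := map_zero (G.heisenbergMul u)

theorem Heisenberg.tmul_mul_tmul (a a' : A) (b b' : G.Dual) :
    Heisenberg.tmul G a b * Heisenberg.tmul G a' b' =
      G.heisenbergTwist a a' (G.dualT₁ (b ⊗ₜ b')) := rfl

/-- The rank one operator `x ↦ a ⟨x, b⟩` on `A`. -/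
def rankOne (a : A) (b : G.Dual) : Module.End ℂ A := (G.toFunctional b).smulRight a

theorem rankOne_apply (a x : A) (b : G.Dual) : G.rankOne a b x = G.pairing x b • a := rfl

/-- The algebra of operators on `A` spanned by the rank one operators `x ↦ a ⟨x, b⟩`. -/
def finiteRankAlgebra : NonUnitalSubalgebra ℂ (Module.End ℂ A) where
  __ := Submodule.span ℂ {T : Module.End ℂ A | ∃ a b, T = G.rankOne a b}
  mul_mem' := by
    intro S T hS hT
    refine Submodule.span_induction₂ (p := fun S T _ _ => S * T ∈
      Submodule.span ℂ {T : Module.End ℂ A | ∃ a b, T = G.rankOne a b}) ?_ ?_ ?_ ?_ ?_ ?_ ?_ hS hT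
    · rintro _ _ ⟨a, b, rfl⟩ ⟨a', b', rfl⟩
      have : G.rankOne a b * G.rankOne a' b' = G.pairing a' b • G.rankOne a b' := by
        ext x
        simp [rankOne_apply, smul_smul, mul_comm]
      rw [this]
      exact Submodule.smul_mem _ _ (Submodule.subset_span ⟨a, b', rfl⟩)
    · intro T _; simp
    · intro T _; simp
    · intro S T U _ _ _ h h'; rw [add_mul]; exact add_mem h h'
    · intro S T U _ _ _ h h'; rw [mul_add]; exact add_mem h h'
    · intro r S T _ _ h; rw [smul_mul_assoc]; exact Submodule.smul_mem _ _ h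
    · intro r S T _ _ h; rw [mul_smul_comm]; exact Submodule.smul_mem _ _ h

end AlgebraicQuantumGroup

end QGroup

end

/-! The action is shown to be faithful, to have the finite rank operators as its range, and to be
multiplicative; these three facts are independent of each other.

The range is the essential point, and it rests on the antipode `S` and strong left invariance of
`φ`. The element `a ⊗ φ( · c)` acts as `x ↦ a (ι ⊗ φ)(Δ(x)(1 ⊗ c))`. Strong invariance reads `S((ι ⊗
φ)(Δ(x)(1 ⊗ c))) = (ι ⊗ φ)((1 ⊗ x)Δ(c))`, and `S` reverses products, so applying `S` to the operator
gives `x ↦ (ι ⊗ φ)((1 ⊗ x)Δ(c)(S(a) ⊗ 1))` (`antipode_heisenbergAction`). This has finite rank,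
because `Δ(c)(S(a) ⊗ 1)` lies in `A ⊗ A`. Since `S` and `T₃` are bijective, every finite rank
operator arises in this way (`range_heisenbergAction`).

The antipode is not part of the definition and is extracted from coassociativity: `exists_counit`
gives `ε`, and `exists_antipode` gives `S` with `T₂ (S ⊗ ι) T₁ = T₄`. In this form strong invariance
is simply `ι ⊗ φ` applied to both sides, as `ι ⊗ φ` absorbs `T₂` (`sl_T₂`).

Faithfulness (`heisenbergAction_injective`) follows from surjectivity of `T₃` and the separation of
`Â` by `A`. Multiplicativity (`heisenbergAction_mul_tmul`) combines `Δ(aa') = Δ(a)Δ(a')` with `Δ(b ▷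
x) = (ι ⊗ b ▷)Δ(x)`. -/

noncomputable section

namespace QGroup

/-! ### Multiplier legs and slice maps -/

section Legs

variable {A : Type*} [NonUnitalRing A] [Module ℂ A] [SMulCommClass ℂ A A] [IsScalarTower ℂ A A]

theorem leg₂_mul (x y : A) : leg₂ (x * y) = leg₂ x * leg₂ y := by
  apply MultiplierAlgebra.ext' <;> refine TensorProduct.ext' fun p q => ?_
  · change p ⊗ₜ[ℂ] (x * y * q) = p ⊗ₜ (x * (y * q))
    rw [mul_assoc]
  · change p ⊗ₜ[ℂ] (q * (x * y)) = p ⊗ₜ ((q * x) * y)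
    rw [mul_assoc]

theorem leg₁_mul_leg₂_comm (x y : A) : leg₁ x * leg₂ y = leg₂ y * leg₁ x := by
  rw [leg₁_mul_leg₂, leg₂_mul_leg₁]

theorem flipM_leg₁ (x : A) : flipM (leg₁ x) = leg₂ x := by
  rw [← flipM_leg₂, flipM_flipM]

theorem lTensor_mul'_assoc_tmul (t : A ⊗[ℂ] A) (c : A) :
    (LinearMap.mul' ℂ A).lTensor A (TensorProduct.assoc ℂ A A A (t ⊗ₜ c)) =
      (leg₂ c).right t := by
  induction t using TensorProduct.induction_on with
  | zero => simp
  | add s t hs ht => simp only [map_add, TensorProduct.add_tmul, hs, ht]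
  | tmul x y => simp

theorem rTensor_sl_assoc_symm (ω : Module.Dual ℂ A) (a : A) (t : A ⊗[ℂ] A) :
    (sl ω).rTensor A ((TensorProduct.assoc ℂ A A A).symm (a ⊗ₜ t)) =
      a ⊗ₜ TensorProduct.lid ℂ A (ω.rTensor A t) := by
  induction t using TensorProduct.induction_on with
  | zero => simp
  | add s t hs ht => simp only [map_add, TensorProduct.tmul_add, hs, ht]
  | tmul x y => simp [TensorProduct.smul_tmul]

theorem sl_rTensor (ω : Module.Dual ℂ A) (f : A →ₗ[ℂ] A) (t : A ⊗[ℂ] A) :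
    sl ω (f.rTensor A t) = f (sl ω t) := by
  induction t using TensorProduct.induction_on with
  | zero => simp
  | add s t hs ht => simp only [map_add, hs, ht]
  | tmul x y => simp

theorem leg₁_left_lTensor (f : A →ₗ[ℂ] A) (x : A) (t : A ⊗[ℂ] A) :
    (leg₁ x).left (f.lTensor A t) = f.lTensor A ((leg₁ x).left t) := by
  induction t using TensorProduct.induction_on with
  | zero => simp
  | add s t hs ht => simp only [map_add, hs, ht]
  | tmul y z => simp

theorem leg₁_right_lTensor (f : A →ₗ[ℂ] A) (x : A) (t : A ⊗[ℂ] A) :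
    (leg₁ x).right (f.lTensor A t) = f.lTensor A ((leg₁ x).right t) := by
  induction t using TensorProduct.induction_on with
  | zero => simp
  | add s t hs ht => simp only [map_add, hs, ht]
  | tmul y z => simp

end Legs

/-! ### Compatibilities among the four canonical maps -/

namespace IsRegularMultiplierHopf

variable {A : Type*} [NonUnitalRing A] [Module ℂ A] [SMulCommClass ℂ A A] [IsScalarTower ℂ A A]
variable {Δ : A →ₙₐ[ℂ] MultiplierAlgebra (A ⊗[ℂ] A)}

/-- `T₄ (a ⊗ b) = (1 ⊗ a)Δ(b)`. -/
def T₄ (h : IsRegularMultiplierHopf Δ) : (A ⊗[ℂ] A) ≃ₗ[ℂ] (A ⊗[ℂ] A) :=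
  h.2.2.choose_spec.choose.trans (TensorProduct.comm ℂ A A)

theorem T₄_spec (h : IsRegularMultiplierHopf Δ) (a b : A) :
    ofElem (h.T₄ (a ⊗ₜ b)) = leg₂ a * Δ b := by
  have h1 := h.2.2.choose_spec.choose_spec.2.1 a b
  have h2 := congrArg flipM h1
  rw [flipM_ofElem, map_mul, flipM_leg₁, NonUnitalAlgHom.comp_apply, flipM_flipM] at h2
  exact h2

theorem T₁_mul_left (h : IsRegularMultiplierHopf Δ) (x y c : A) :
    h.T₁ ((x * y) ⊗ₜ c) = (Δ x).left (h.T₁ (y ⊗ₜ c)) := by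
  apply h.inj
  rw [← mul_ofElem, T₁_spec, T₁_spec, map_mul, mul_assoc]

theorem T₂_leg₁_left (h : IsRegularMultiplierHopf Δ) (e : A) (t : A ⊗[ℂ] A) :
    h.T₂ ((leg₁ e).left t) = (leg₁ e).left (h.T₂ t) := by
  induction t using TensorProduct.induction_on with
  | zero => simp
  | add s t hs ht => simp only [map_add, hs, ht]
  | tmul a b =>
    apply h.inj
    rw [← mul_ofElem, leg₁_left, T₂_spec, T₂_spec, leg₁_mul, mul_assoc]

theorem T₂_leg₂_right (h : IsRegularMultiplierHopf Δ) (d : A) (t : A ⊗[ℂ] A) :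
    h.T₂ ((leg₂ d).right t) = (Δ d).right (h.T₂ t) := by
  induction t using TensorProduct.induction_on with
  | zero => simp
  | add s t hs ht => simp only [map_add, hs, ht]
  | tmul a b =>
    apply h.inj
    rw [← ofElem_mul, leg₂_right, T₂_spec, T₂_spec, map_mul, mul_assoc]

/-- Both sides are `(a ⊗ 1)Δ(b)(1 ⊗ c)`, bracketed differently. -/
theorem T₂_leg₂ (h : IsRegularMultiplierHopf Δ) (a b c : A) :
    (leg₂ c).right (h.T₂ (a ⊗ₜ b)) = (leg₁ a).left (h.T₁ (b ⊗ₜ c)) := by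
  apply h.inj
  rw [← ofElem_mul, ← mul_ofElem, T₂_spec, T₁_spec, mul_assoc]

theorem T₂_leg₁_right (h : IsRegularMultiplierHopf Δ) (a b c : A) :
    (leg₁ c).right (h.T₂ (a ⊗ₜ b)) = (leg₁ a).left (h.T₃ (b ⊗ₜ c)) := by
  apply h.inj
  rw [← ofElem_mul, ← mul_ofElem, T₂_spec, T₃_spec, mul_assoc]

theorem T₄_leg₁_right (h : IsRegularMultiplierHopf Δ) (x b c : A) :
    (leg₁ c).right (h.T₄ (x ⊗ₜ b)) = (leg₂ x).left (h.T₃ (b ⊗ₜ c)) := by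
  apply h.inj
  rw [← ofElem_mul, ← mul_ofElem, T₄_spec, T₃_spec, mul_assoc]

theorem leg₁_left_T₄ (h : IsRegularMultiplierHopf Δ) (e x c : A) :
    (leg₁ e).left (h.T₄ (x ⊗ₜ c)) = (Δ c).right (e ⊗ₜ x) := by
  apply h.inj
  rw [← ofElem_mul, ← mul_ofElem, T₄_spec, ← leg₁_mul_leg₂, mul_assoc]

theorem T₄_mul_left (h : IsRegularMultiplierHopf Δ) (x y c : A) :
    h.T₄ ((x * y) ⊗ₜ c) = (leg₂ x).left (h.T₄ (y ⊗ₜ c)) := by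
  apply h.inj
  rw [← mul_ofElem, T₄_spec, T₄_spec, leg₂_mul, mul_assoc]

theorem leg₂_left_T₂ (h : IsRegularMultiplierHopf Δ) (s x q : A) :
    (leg₂ x).left (h.T₂ (s ⊗ₜ q)) = (leg₁ s).left (h.T₄ (x ⊗ₜ q)) := by
  apply h.inj
  rw [← mul_ofElem, ← mul_ofElem, T₂_spec, T₄_spec, ← mul_assoc, ← mul_assoc,
    leg₁_mul_leg₂_comm]

theorem Δ_left_tmul (h : IsRegularMultiplierHopf Δ) (x p q : A) :
    (Δ x).left (p ⊗ₜ q) = (leg₁ p).right (h.T₁ (x ⊗ₜ q)) := by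
  apply h.inj
  rw [← mul_ofElem, ← ofElem_mul, T₁_spec, mul_assoc, leg₂_mul_leg₁]

/-! ### Counit and antipode from coassociativity -/

/-- Coassociativity on arbitrary tensors: `(T₂ ⊗ ι)(ι ⊗ T₁) = (ι ⊗ T₁)(T₂ ⊗ ι)`. -/
theorem coassoc_tensor (h : IsRegularMultiplierHopf Δ) (r : A ⊗[ℂ] A) (c : A) :
    TensorProduct.assoc ℂ A A A (h.T₂.toLinearMap.rTensor A ((TensorProduct.assoc ℂ A A A).symm
      (h.T₁.toLinearMap.lTensor A (TensorProduct.assoc ℂ A A A (r ⊗ₜ c))))) =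
    h.T₁.toLinearMap.lTensor A (TensorProduct.assoc ℂ A A A (h.T₂ r ⊗ₜ c)) := by
  induction r using TensorProduct.induction_on with
  | zero => simp
  | add s t hs ht => simp only [map_add, TensorProduct.add_tmul, hs, ht]
  | tmul a b =>
    rw [← h.coassoc]
    simp

/-- For `u = b ⊗ c`, coassociativity brings `T₁` to the outside, where `T₁⁻¹` cancels it;
multiplying the last two legs leaves `(a ⊗ 1)Δ(b)(1 ⊗ c)`. -/
theorem lTensor_mul_T₁_symm (h : IsRegularMultiplierHopf Δ) (a : A) (u : A ⊗[ℂ] A) :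
    (LinearMap.mul' ℂ A ∘ₗ h.T₁.symm.toLinearMap).lTensor A (TensorProduct.assoc ℂ A A A
      (h.T₂.toLinearMap.rTensor A ((TensorProduct.assoc ℂ A A A).symm (a ⊗ₜ h.T₁ u)))) =
      (leg₁ a).left (h.T₁ u) := by
  induction u using TensorProduct.induction_on with
  | zero => simp
  | add s t hs ht => simp only [map_add, TensorProduct.tmul_add, hs, ht]
  | tmul b c =>
    rw [h.coassoc, ← LinearMap.comp_apply, ← LinearMap.lTensor_comp, LinearMap.comp_assoc,
      LinearEquiv.symm_comp, LinearMap.comp_id, lTensor_mul'_assoc_tmul, T₂_leg₂]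

/-- The counit should satisfy `ε(q)c = m T₁⁻¹(q ⊗ c)` and `ε(q)p = m T₂⁻¹(p ⊗ q)`, with `m` the
product. This identity lets each expression force the other to be a scalar multiple. -/
theorem tmul_mul_T₁_symm (h : IsRegularMultiplierHopf Δ) (p q c : A) :
    p ⊗ₜ[ℂ] LinearMap.mul' ℂ A (h.T₁.symm (q ⊗ₜ c)) =
      LinearMap.mul' ℂ A (h.T₂.symm (p ⊗ₜ q)) ⊗ₜ[ℂ] c := by
  have key : ∀ r : A ⊗[ℂ] A, (LinearMap.mul' ℂ A ∘ₗ h.T₁.symm.toLinearMap).lTensor A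
      (TensorProduct.assoc ℂ A A A (h.T₂ r ⊗ₜ c)) = LinearMap.mul' ℂ A r ⊗ₜ c := by
    intro r
    induction r using TensorProduct.induction_on with
    | zero => simp
    | add s t hs ht => simp only [map_add, TensorProduct.add_tmul, hs, ht]
    | tmul a b =>
      have := h.lTensor_mul_T₁_symm a (h.T₁.symm (b ⊗ₜ c))
      simpa using this
  simpa using key (h.T₂.symm (p ⊗ₜ q))

/-- Once `m T₁⁻¹(q ⊗ c) = ε(q)c` is known, evaluating it on `T₁(b ⊗ c)` gives the counit identity.
-/
theorem exists_counit [Nontrivial A] (h : IsRegularMultiplierHopf Δ) : ∃ ε : Module.Dual ℂ A,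
    ∀ b c, TensorProduct.lid ℂ A (ε.rTensor A (h.T₁ (b ⊗ₜ c))) = b * c := by
  obtain ⟨z, hz⟩ := exists_ne (0 : A)
  obtain ⟨η, hη⟩ := Module.Projective.exists_dual_ne_zero ℂ hz
  let E : A ⊗[ℂ] A →ₗ[ℂ] A := LinearMap.mul' ℂ A ∘ₗ h.T₁.symm.toLinearMap
  -- The scalar by which `E(q ⊗ · )` should act, read off at the test vector `z` with `η`.
  let ε : Module.Dual ℂ A := (η z)⁻¹ • (η ∘ₗ E ∘ₗ (TensorProduct.mk ℂ A A).flip z)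
  have hE : ∀ q c, E (q ⊗ₜ c) = ε q • c := by
    intro q c
    have h1 := congrArg (sl η) (h.tmul_mul_T₁_symm z q z)
    have h2 := congrArg ((TensorProduct.lid ℂ A).toLinearMap ∘ₗ η.rTensor A) (h.tmul_mul_T₁_symm z q c)
    have h3 := congrArg η h1
    simp only [sl_tmul, map_smul, smul_eq_mul] at h3
    simp only [LinearMap.comp_apply, LinearMap.rTensor_tmul, LinearEquiv.coe_coe,
      TensorProduct.lid_tmul] at h2
    have h4 : η (LinearMap.mul' ℂ A (h.T₂.symm (z ⊗ₜ q))) = η z * ε q := by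
      simp only [ε, E, LinearMap.smul_apply, LinearMap.comp_apply, smul_eq_mul,
        LinearMap.flip_apply, TensorProduct.mk_apply, LinearEquiv.coe_coe]
      field_simp
      exact mul_right_cancel₀ hη (by linear_combination -h3)
    rw [h4, mul_smul] at h2
    exact smul_right_injective A hη h2
  refine ⟨ε, fun b c => ?_⟩
  have : ∀ t, TensorProduct.lid ℂ A (ε.rTensor A t) = E t := by
    intro t
    induction t using TensorProduct.induction_on with
    | zero => simp
    | add s t hs ht => simp only [map_add, hs, ht]
    | tmul x y => simp [hE]
  rw [this]
  simp [E]

/-- `T₂⁻¹(e ⊗ x)(1 ⊗ c) = (κ ⊗ ι)(Δ(x)(1 ⊗ c))`, where `κ(p) = (ι ⊗ ε)T₂⁻¹(e ⊗ p)` is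
`e` times the antipode of `p`. -/
theorem T₂_symm_leg₂_right (h : IsRegularMultiplierHopf Δ) {ε : Module.Dual ℂ A}
    (hε : ∀ b c, TensorProduct.lid ℂ A (ε.rTensor A (h.T₁ (b ⊗ₜ c))) = b * c) (e x c : A) :
    (sl ε ∘ₗ h.T₂.symm.toLinearMap ∘ₗ TensorProduct.mk ℂ A A e).rTensor A (h.T₁ (x ⊗ₜ c)) =
      (leg₂ c).right (h.T₂.symm (e ⊗ₜ x)) := by
  have h1 : ∀ w : A ⊗[ℂ] A,
      (sl ε ∘ₗ h.T₂.symm.toLinearMap ∘ₗ TensorProduct.mk ℂ A A e).rTensor A w =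
      (sl ε).rTensor A (h.T₂.symm.toLinearMap.rTensor A
        ((TensorProduct.assoc ℂ A A A).symm (e ⊗ₜ w))) := by
    intro w
    induction w using TensorProduct.induction_on with
    | zero => simp
    | add s t hs ht => simp only [map_add, TensorProduct.tmul_add, hs, ht]
    | tmul y z => simp
  have h2 : ∀ r : A ⊗[ℂ] A, (sl ε).rTensor A ((TensorProduct.assoc ℂ A A A).symm
      (h.T₁.toLinearMap.lTensor A (TensorProduct.assoc ℂ A A A (r ⊗ₜ c)))) =
      (leg₂ c).right r := by
    intro r
    induction r using TensorProduct.induction_on with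
    | zero => simp
    | add s t hs ht => simp only [map_add, TensorProduct.add_tmul, hs, ht]
    | tmul a b =>
      rw [TensorProduct.assoc_tmul, LinearMap.lTensor_tmul, rTensor_sl_assoc_symm]
      exact congrArg (a ⊗ₜ[ℂ] ·) (hε b c)
  -- With `r = T₂⁻¹(e ⊗ x)`, coassociativity becomes `(T₂⁻¹ ⊗ ι)(e ⊗ T₁(x ⊗ c)) = (ι ⊗ T₁)(r ⊗ c)`;
  -- applying `ε` to the middle leg turns the right side into `r(1 ⊗ c)`.
  have h3 := h.coassoc_tensor (h.T₂.symm (e ⊗ₜ x)) c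
  rw [LinearEquiv.apply_symm_apply, TensorProduct.assoc_tmul, LinearMap.lTensor_tmul,
    ← LinearEquiv.eq_symm_apply] at h3
  rw [h1]
  erw [← h3]
  rw [← LinearMap.comp_apply (LinearMap.rTensor A h.T₂.symm.toLinearMap),
    ← LinearMap.rTensor_comp, LinearEquiv.symm_comp, LinearMap.rTensor_id, LinearMap.id_apply, h2]

/-- The antipode: a linear bijection `S` of `A` with
`(S ⊗ ι)(Δ(x)(1 ⊗ c)) = T₂⁻¹((1 ⊗ x)Δ(c))`. -/
theorem exists_antipode [Nontrivial A] (h : IsRegularMultiplierHopf Δ) : ∃ S : A ≃ₗ[ℂ] A,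
    ∀ t, h.T₂ (S.toLinearMap.rTensor A (h.T₁ t)) = h.T₄ t := by
  obtain ⟨ε, hε⟩ := h.exists_counit
  obtain ⟨z, hz⟩ := exists_ne (0 : A)
  obtain ⟨η, hη⟩ := Module.Projective.exists_dual_ne_zero ℂ hz
  let κ : A → A →ₗ[ℂ] A := fun e => sl ε ∘ₗ h.T₂.symm.toLinearMap ∘ₗ TensorProduct.mk ℂ A A e
  -- `Θ = T₂⁻¹ T₄ T₁⁻¹` is the bijection that has to be shown to be of the form `S ⊗ ι`.
  let Θ : (A ⊗[ℂ] A) ≃ₗ[ℂ] (A ⊗[ℂ] A) := h.T₁.symm.trans (h.T₄.trans h.T₂.symm)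
  -- After left multiplication by `e ⊗ 1`, `Θ` acts on the first leg only: on `T₁(x ⊗ c)`, both
  -- sides become `(e ⊗ x)Δ(c)` under `T₂`.
  have hκ : ∀ e t, (κ e).rTensor A t = (leg₁ e).left (Θ t) := by
    intro e t
    obtain ⟨t, rfl⟩ := h.T₁.surjective t
    apply h.T₂.injective
    rw [T₂_leg₁_left]
    simp only [Θ, LinearEquiv.trans_apply, LinearEquiv.symm_apply_apply,
      LinearEquiv.apply_symm_apply]
    induction t using TensorProduct.induction_on with
    | zero => simp
    | add s t hs ht => simp only [map_add, hs, ht]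
    | tmul x c =>
      rw [h.T₂_symm_leg₂_right hε, T₂_leg₂_right, LinearEquiv.apply_symm_apply, leg₁_left_T₄]
  let S : A →ₗ[ℂ] A := (η z)⁻¹ • (sl η ∘ₗ Θ.toLinearMap ∘ₗ (TensorProduct.mk ℂ A A).flip z)
  have hS : ∀ e p, e * S p = κ e p := by
    intro e p
    have := congrArg (sl η) (hκ e (p ⊗ₜ z))
    rw [sl_leg₁_left, LinearMap.rTensor_tmul, sl_tmul] at this
    simp only [S, LinearMap.smul_apply, mul_smul_comm, LinearMap.comp_apply,
      LinearMap.flip_apply, TensorProduct.mk_apply, LinearEquiv.coe_coe]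
    rw [← this, smul_smul, inv_mul_cancel₀ hη, one_smul]
  have hSΘ : ∀ t, S.rTensor A t = Θ t := by
    intro t
    refine sub_eq_zero.1 (leg₁_left_separates h.1.1 _ fun e => ?_)
    rw [map_sub, sub_eq_zero, ← hκ]
    induction t using TensorProduct.induction_on with
    | zero => simp
    | add s t hs ht => simp only [map_add, hs, ht]
    | tmul x y => simp [hS]
  -- As `Θ = S ⊗ ι` is bijective, testing the second leg on `z` with `η` transfers bijectivity to
  -- `S`.
  have hbij : Function.Bijective S := by
    constructor
    · rw [injective_iff_map_eq_zero]
      intro p hp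
      have h1 : Θ (p ⊗ₜ z) = 0 := by rw [← hSΘ, LinearMap.rTensor_tmul, hp, TensorProduct.zero_tmul]
      have h2 := congrArg (sl η) ((LinearEquiv.map_eq_zero_iff Θ).1 h1)
      rw [sl_tmul, map_zero] at h2
      exact (smul_eq_zero.1 h2).resolve_left hη
    · intro a
      refine ⟨(η z)⁻¹ • sl η (Θ.symm (a ⊗ₜ z)), ?_⟩
      rw [map_smul, ← sl_rTensor, hSΘ, LinearEquiv.apply_symm_apply, sl_tmul, smul_smul,
        inv_mul_cancel₀ hη, one_smul]
  refine ⟨LinearEquiv.ofBijective S hbij, fun t => ?_⟩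
  have : (LinearEquiv.ofBijective S hbij).toLinearMap = S := rfl
  rw [this, hSΘ]
  simp [Θ]

/-- Antimultiplicativity follows from the defining relation alone, by computing `T₂(S ⊗ ι)` on
`Δ(x)(b ⊗ q) = T₁(x ⊗ q)(b ⊗ 1)` in two ways. -/
theorem antipode_mul (h : IsRegularMultiplierHopf Δ) {S : A →ₗ[ℂ] A}
    (hS : ∀ t, h.T₂ (S.rTensor A (h.T₁ t)) = h.T₄ t) (a b : A) : S (a * b) = S b * S a := by
  have h1 : ∀ x t, h.T₂ (S.rTensor A ((Δ x).left t)) =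
      (leg₂ x).left (h.T₂ (S.rTensor A t)) := by
    intro x t
    obtain ⟨t, rfl⟩ := h.T₁.surjective t
    induction t using TensorProduct.induction_on with
    | zero => simp
    | add s t hs ht => simp only [map_add, hs, ht]
    | tmul y c => rw [← T₁_mul_left, hS, hS, T₄_mul_left]
  have h2 : ∀ t, S.rTensor A ((leg₁ b).right t) = (leg₁ (S b)).left (S.rTensor A t) := by
    intro t
    obtain ⟨t, rfl⟩ := h.T₁.surjective t
    apply h.T₂.injective
    induction t using TensorProduct.induction_on with
    | zero => simp
    | add s t hs ht => simp only [map_add, hs, ht]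
    | tmul x q =>
      rw [← Δ_left_tmul, h1, LinearMap.rTensor_tmul, leg₂_left_T₂, T₂_leg₁_left, hS]
  by_contra hne
  obtain ⟨η, hη⟩ := Module.Projective.exists_dual_ne_zero ℂ (sub_ne_zero.2 hne)
  -- The difference serves only as a second leg on which `η` does not vanish, so that it can be
  -- cancelled.
  have h3 := congrArg (sl η) (h2 (a ⊗ₜ (S (a * b) - S b * S a)))
  simp only [leg₁_right, LinearMap.rTensor_tmul, leg₁_left, sl_tmul] at h3
  exact hne (smul_right_injective A hη h3)

end IsRegularMultiplierHopf

/-! ### Invariance of the integral and covariance of the dual action -/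

namespace AlgebraicQuantumGroup

variable {A : Type*} [NonUnitalRing A] [Module ℂ A] [SMulCommClass ℂ A A] [IsScalarTower ℂ A A]
variable (G : AlgebraicQuantumGroup A)

theorem nontrivial (G : AlgebraicQuantumGroup A) : Nontrivial A := by
  by_contra hA
  rw [not_nontrivial_iff_subsingleton] at hA
  exact G.φ_ne_zero (LinearMap.ext fun a => by rw [Subsingleton.elim a 0, map_zero, map_zero])

/-- Left invariance in the form `(ι ⊗ φ)((q ⊗ 1)Δ(p)) = φ(p)q`. -/
theorem sl_T₂ (t : A ⊗[ℂ] A) : sl G.φ (G.regular.T₂ t) = sl G.φ t := by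
  induction t using TensorProduct.induction_on with
  | zero => simp
  | add s t hs ht => simp only [map_add, hs, ht]
  | tmul q p =>
    rw [sl_tmul]
    exact congrArg (fun m : MultiplierAlgebra A => m.right q) (G.left_invariant p)

/-- This is `Δ(b ▷ x) = (ι ⊗ b ▷)Δ(x)` multiplied on the left by `e ⊗ 1`. It is coassociativity
sliced by `φ` in the last leg. -/
theorem T₂_act (b : G.Dual) (e x : A) :
    G.regular.T₂ (e ⊗ₜ G.act b x) = (G.act b).lTensor A (G.regular.T₂ (e ⊗ₜ x)) := by
  obtain ⟨c, rfl⟩ := G.hat_surjective b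
  have : ∀ t : A ⊗[ℂ] A, (G.act (G.hat c)).lTensor A t = (sl G.φ).lTensor A
      (G.regular.T₁.toLinearMap.lTensor A (TensorProduct.assoc ℂ A A A (t ⊗ₜ c))) := by
    intro t
    induction t using TensorProduct.induction_on with
    | zero => simp
    | add s t hs ht => simp only [map_add, TensorProduct.add_tmul, hs, ht]
    | tmul x y => simp [act_hat]
  rw [act_hat, T₂_sl, G.regular.coassoc, this]

theorem T₃_act (b : G.Dual) (x z : A) :
    G.regular.T₃ (G.act b x ⊗ₜ z) = (G.act b).lTensor A (G.regular.T₃ (x ⊗ₜ z)) := by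
  refine sub_eq_zero.1 (leg₁_left_separates G.regular.1.1 _ fun e => ?_)
  rw [map_sub, sub_eq_zero, leg₁_left_lTensor, ← G.regular.T₂_leg₁_right,
    ← G.regular.T₂_leg₁_right, T₂_act, leg₁_right_lTensor]

theorem act_mul (b : G.Dual) (a x : A) :
    G.act b a * x = sl (G.toFunctional b) (G.regular.T₃ (a ⊗ₜ x)) :=
  congrArg (fun m : MultiplierAlgebra A => m.left x) (G.ofElem_act b a)

/-! ### The action and its range -/

/-- The Heisenberg algebra acts on `A`: `a ⊗ b` acts as `x ↦ a (b ▷ x)`. -/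
def heisenbergAction : A ⊗[ℂ] G.Dual →ₗ[ℂ] Module.End ℂ A :=
  TensorProduct.lift ((LinearMap.llcomp ℂ A A A ∘ₗ LinearMap.mul ℂ A).compl₂ G.act)

@[simp] theorem heisenbergAction_tmul (a x : A) (b : G.Dual) :
    G.heisenbergAction (a ⊗ₜ b) x = a * G.act b x := rfl

/-- The map sending `a ⊗ b` to the rank one operator `x ↦ a ⟨x, b⟩`. -/
def rankOneMap : A ⊗[ℂ] G.Dual →ₗ[ℂ] Module.End ℂ A :=
  TensorProduct.lift (LinearMap.mk₂ ℂ G.rankOne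
    (fun a a' b => LinearMap.ext fun x => by simp [rankOne_apply])
    (fun r a b => LinearMap.ext fun x => by exact smul_comm _ r a)
    (fun a b b' => LinearMap.ext fun x => by simp [rankOne_apply, add_smul])
    (fun r a b => LinearMap.ext fun x => by simp [rankOne_apply, mul_smul]))

@[simp] theorem rankOneMap_tmul (a x : A) (b : G.Dual) :
    G.rankOneMap (a ⊗ₜ b) x = G.pairing x b • a := rfl

theorem range_rankOneMap :
    LinearMap.range G.rankOneMap = G.finiteRankAlgebra.toSubmodule := by
  change _ = Submodule.span ℂ {T : Module.End ℂ A | ∃ a b, T = G.rankOne a b}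
  apply le_antisymm
  · rintro _ ⟨t, rfl⟩
    induction t using TensorProduct.induction_on with
    | zero => simp
    | add s t hs ht => rw [map_add]; exact add_mem hs ht
    | tmul a b => exact Submodule.subset_span ⟨a, b, rfl⟩
  · rw [Submodule.span_le]
    rintro _ ⟨a, b, rfl⟩
    exact ⟨a ⊗ₜ b, rfl⟩

/-- The action of `a ⊗ φ( · c)` is `∑ᵢ S⁻¹(pᵢ) φ( · qᵢ)`, where `∑ᵢ pᵢ ⊗ qᵢ = Δ(c)(S(a) ⊗ 1)`. -/
theorem antipode_heisenbergAction {S : A →ₗ[ℂ] A}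
    (hS : ∀ t, G.regular.T₂ (S.rTensor A (G.regular.T₁ t)) = G.regular.T₄ t) (a c x : A) :
    S (G.heisenbergAction (a ⊗ₜ G.hat c) x) =
      G.rankOneMap (G.hat.lTensor A (G.regular.T₃ (c ⊗ₜ S a))) x := by
  have h1 : ∀ t : A ⊗[ℂ] A, G.rankOneMap (G.hat.lTensor A t) x = sl G.φ ((leg₂ x).left t) := by
    intro t
    induction t using TensorProduct.induction_on with
    | zero => simp
    | add s t hs ht => simp only [map_add, LinearMap.add_apply, hs, ht]
    | tmul p q => simp [pairing_hat]
  -- Strong left invariance: `T₄(x ⊗ c)` is replaced by `T₂(S ⊗ ι)T₁(x ⊗ c)`, `ι ⊗ φ` absorbs `T₂`,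
  -- and `S` comes out of the slice.
  rw [h1, ← G.regular.T₄_leg₁_right, sl_leg₁_right, ← hS, sl_T₂, sl_rTensor, ← act_hat,
    heisenbergAction_tmul, G.regular.antipode_mul hS]

/-- On `A ⊗ A`, the action and the rank one map differ by a linear automorphism of the source, so
their ranges coincide. -/
theorem range_heisenbergAction :
    LinearMap.range G.heisenbergAction = G.finiteRankAlgebra.toSubmodule := by
  have := G.nontrivial
  obtain ⟨S, hS⟩ := G.regular.exists_antipode
  -- `Γ(a ⊗ c) = (S⁻¹ ⊗ ι)(Δ(c)(S(a) ⊗ 1))`, as dictated by `antipode_heisenbergAction`.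
  let Γ : (A ⊗[ℂ] A) ≃ₗ[ℂ] (A ⊗[ℂ] A) :=
    (TensorProduct.congr S (LinearEquiv.refl ℂ A)).trans ((TensorProduct.comm ℂ A A).trans
      (G.regular.T₃.trans (TensorProduct.congr S.symm (LinearEquiv.refl ℂ A))))
  have hrank : ∀ t x, G.rankOneMap (G.hat.lTensor A
      (TensorProduct.congr S.symm (LinearEquiv.refl ℂ A) t)) x =
      S.symm (G.rankOneMap (G.hat.lTensor A t) x) := by
    intro t x
    induction t using TensorProduct.induction_on with
    | zero => simp
    | add s t hs ht => simp only [map_add, LinearMap.add_apply, hs, ht]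
    | tmul p q => simp
  have hΓ : G.heisenbergAction ∘ₗ G.hat.lTensor A =
      (G.rankOneMap ∘ₗ G.hat.lTensor A) ∘ₗ Γ.toLinearMap := by
    refine TensorProduct.ext' fun a c => LinearMap.ext fun x => ?_
    apply S.injective
    refine (G.antipode_heisenbergAction hS a c x).trans ?_
    simp only [LinearMap.comp_apply, LinearEquiv.coe_coe, Γ, LinearEquiv.trans_apply, hrank,
      LinearEquiv.apply_symm_apply]
    simp
  have hhat : LinearMap.range (G.hat.lTensor A) = ⊤ :=
    LinearMap.range_eq_top.2 (LinearMap.lTensor_surjective A G.hat_surjective)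
  rw [← range_rankOneMap, ← LinearMap.range_comp_of_range_eq_top _ hhat, hΓ,
    LinearMap.range_comp_of_range_eq_top _ Γ.range, LinearMap.range_comp_of_range_eq_top _ hhat]

/-! ### Faithfulness -/

theorem eq_zero_of_pairing (t : A ⊗[ℂ] G.Dual)
    (ht : ∀ u v : A, TensorProduct.rid ℂ A ((G.pairing v).lTensor A t) * u = 0) : t = 0 := by
  have h1 : ∀ v, (G.pairing v).rTensor A (TensorProduct.comm ℂ A G.Dual t) = 0 := by
    intro v
    have h2 : TensorProduct.rid ℂ A ((G.pairing v).lTensor A t) = 0 := G.regular.1.1.1 _ (ht · v)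
    have h3 : (G.pairing v).lTensor A t = 0 := (LinearEquiv.map_eq_zero_iff _).1 h2
    have h4 := LinearMap.congr_fun (LinearMap.comm_comp_lTensor_comp_comm_eq (G.pairing v) (Q := A))
      (TensorProduct.comm ℂ A G.Dual t)
    simp [h3] at h4
    exact h4.symm
  have := rTensor_separates (fun v => G.pairing v)
    (fun b hb => G.toFunctional_injective (LinearMap.ext hb)) _ h1
  exact (LinearEquiv.map_eq_zero_iff _).1 this

/-- The pairing of `A ⊗ Â` with `A ⊗ A` given by `(a ⊗ b, u ⊗ v) ↦ ⟨v, b⟩ a u`. -/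
def slicePairing : A ⊗[ℂ] G.Dual →ₗ[ℂ] A ⊗[ℂ] A →ₗ[ℂ] A :=
  TensorProduct.lift (LinearMap.mk₂ ℂ (fun a b => LinearMap.mulLeft ℂ a ∘ₗ sl (G.toFunctional b))
    (fun a a' b => by rw [mulLeft_add', LinearMap.add_comp])
    (fun r a b => by rw [mulLeft_smul', LinearMap.smul_comp])
    (fun a b b' => by rw [map_add, map_add, LinearMap.comp_add])
    (fun r a b => by rw [map_smul, map_smul, LinearMap.comp_smul]))

theorem slicePairing_tmul (a : A) (b : G.Dual) (w : A ⊗[ℂ] A) :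
    G.slicePairing (a ⊗ₜ b) w = a * sl (G.toFunctional b) w := rfl

theorem slicePairing_tmul_right (t : A ⊗[ℂ] G.Dual) (u v : A) :
    G.slicePairing t (u ⊗ₜ v) = TensorProduct.rid ℂ A ((G.pairing v).lTensor A t) * u := by
  induction t using TensorProduct.induction_on with
  | zero => simp
  | add s t hs ht => simp only [map_add, LinearMap.add_apply, hs, ht, add_mul]
  | tmul a b => simp [slicePairing_tmul, pairing, smul_mul_assoc, mul_smul_comm]

/-- Since `T₃` is onto, the operator of `t` determines the pairing of `t` with all of `A ⊗ A`. -/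
theorem slicePairing_T₃ (t : A ⊗[ℂ] G.Dual) (x y : A) :
    G.slicePairing t (G.regular.T₃ (x ⊗ₜ y)) = G.heisenbergAction t x * y := by
  induction t using TensorProduct.induction_on with
  | zero => simp
  | add s t hs ht => simp only [map_add, LinearMap.add_apply, hs, ht, add_mul]
  | tmul a b => rw [slicePairing_tmul, heisenbergAction_tmul, mul_assoc, act_mul]

/-- The action of the Heisenberg algebra on `A` is faithful. -/
theorem heisenbergAction_injective : Function.Injective G.heisenbergAction := by
  rw [injective_iff_map_eq_zero]
  intro t ht
  have h1 : G.slicePairing t ∘ₗ G.regular.T₃.toLinearMap = 0 :=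
    TensorProduct.ext' fun x y => (G.slicePairing_T₃ t x y).trans (by rw [ht]; simp)
  refine G.eq_zero_of_pairing t fun u v => ?_
  rw [← slicePairing_tmul_right]
  simpa using LinearMap.congr_fun h1 (G.regular.T₃.symm (u ⊗ₜ v))

/-! ### Multiplicativity -/

/-- The map `(u ⊗ v, u' ⊗ v') ↦ f(v ⊗ v') u u'`. -/
def pairMul (f : Module.Dual ℂ (A ⊗[ℂ] A)) (w w' : A ⊗[ℂ] A) : A :=
  TensorProduct.rid ℂ A (TensorProduct.map (LinearMap.mul' ℂ A) f
    (TensorProduct.tensorTensorTensorComm ℂ A A A A (w ⊗ₜ w')))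

theorem pairMul_pairing₂ (p q : G.Dual) (w w' : A ⊗[ℂ] A) :
    pairMul (G.pairing₂ (p ⊗ₜ q)) w w' = sl (G.toFunctional p) w * sl (G.toFunctional q) w' := by
  unfold pairMul
  induction w using TensorProduct.induction_on with
  | zero => simp
  | add s t hs ht => simp only [map_add, TensorProduct.add_tmul, hs, ht, add_mul]
  | tmul u v =>
    induction w' using TensorProduct.induction_on with
    | zero => simp
    | add s t hs ht => simp only [map_add, TensorProduct.tmul_add, hs, ht, mul_add]
    | tmul u' v' => simp [pairing, smul_mul_assoc, mul_smul_comm, mul_smul, smul_comm (G.toFunctional q v')]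

theorem pairMul_coprodFunctional (b b' : G.Dual) (w w' : A ⊗[ℂ] A) :
    pairMul (G.coprodFunctional (b ⊗ₜ b')) w w' =
      sl (G.toFunctional b) (w * (G.act b').lTensor A w') := by
  unfold pairMul
  induction w using TensorProduct.induction_on with
  | zero => simp
  | add s t hs ht => simp only [map_add, TensorProduct.add_tmul, hs, ht, add_mul]
  | tmul u v =>
    induction w' using TensorProduct.induction_on with
    | zero => simp
    | add s t hs ht => simp only [map_add, TensorProduct.tmul_add, hs, ht, mul_add]
    | tmul u' v' => simp [pairing]

/-- The outer factors `y` and `z` bring `Δ(a')` and `Δ(x)` into `A ⊗ A`. The twist then depends on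
`t` only through its pairing functional, which is all that is known about `dualT₁`. -/
theorem mul_heisenbergTwist_mul (a a' x y z : A) (t : G.Dual ⊗[ℂ] G.Dual) :
    y * G.heisenbergAction (G.heisenbergTwist a a' t) x * z =
      pairMul (G.pairing₂ t) (G.regular.T₂ ((y * a) ⊗ₜ a')) (G.regular.T₃ (x ⊗ₜ z)) := by
  induction t using TensorProduct.induction_on with
  | zero => simp [pairMul]
  | add s t hs ht =>
    simp only [map_add, LinearMap.add_apply, mul_add, add_mul, hs, ht]
    simp only [pairMul, TensorProduct.map_add_right, LinearMap.add_apply, map_add]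
  | tmul p q =>
    rw [pairMul_pairing₂, ← mul_act, ← act_mul, heisenbergTwist_tmul, heisenbergAction_tmul]
    simp only [mul_assoc]

/-- Between `y` and `z`, both sides equal the slice by `b` of `(ya ⊗ 1)Δ(a')Δ(b' ▷ x)(z ⊗ 1)`;
nondegeneracy then removes `y` and `z`. -/
theorem heisenbergAction_mul_tmul (a a' : A) (b b' : G.Dual) :
    G.heisenbergAction (G.heisenbergTwist a a' (G.dualT₁ (b ⊗ₜ b'))) =
      G.heisenbergAction (a ⊗ₜ b) * G.heisenbergAction (a' ⊗ₜ b') := by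
  refine LinearMap.ext fun x => sub_eq_zero.1 (G.regular.1.1.2 _ fun y =>
    G.regular.1.1.1 _ fun z => ?_)
  -- Here `Δ(a'(b' ▷ x)) = Δ(a')Δ(b' ▷ x)` is used, with each half absorbed into `A ⊗ A` by its own
  -- outer factor.
  have h1 : (leg₁ z).right (G.regular.T₂ ((y * a) ⊗ₜ (a' * G.act b' x))) =
      G.regular.T₂ ((y * a) ⊗ₜ a') * G.regular.T₃ (G.act b' x ⊗ₜ z) := by
    apply G.regular.inj
    change _ = ofElem ((ofElem _).left _)
    rw [← mul_ofElem, ← ofElem_mul, IsRegularMultiplierHopf.T₂_spec,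
      IsRegularMultiplierHopf.T₂_spec, IsRegularMultiplierHopf.T₃_spec, map_mul]
    simp only [mul_assoc]
  rw [mul_sub, sub_mul, sub_eq_zero, mul_heisenbergTwist_mul, pairing₂_dualT₁,
    pairMul_coprodFunctional, ← T₃_act, ← h1, sl_leg₁_right, ← mul_act]
  simp [mul_assoc]

theorem heisenbergAction_mul (u v : G.Heisenberg) :
    G.heisenbergAction (u * v : G.Heisenberg) =
      G.heisenbergAction u * G.heisenbergAction v := by
  have h : (LinearMap.mul ℂ (Module.End ℂ A)).compl₁₂ G.heisenbergAction G.heisenbergAction =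
      G.heisenbergMul.compr₂ G.heisenbergAction :=
    TensorProduct.ext' fun a b => TensorProduct.ext' fun a' b' =>
      (G.heisenbergAction_mul_tmul a a' b b').symm
  exact (LinearMap.congr_fun (LinearMap.congr_fun h u) v).symm

end AlgebraicQuantumGroup
end QGroup

end

theorem proposition3p16 {A : Type*} [NonUnitalRing A] [Module ℂ A] [SMulCommClass ℂ A A]
    [IsScalarTower ℂ A A] (G : QGroup.AlgebraicQuantumGroup A) :
    ∃ e : G.Heisenberg ≃ₗ[ℂ] G.finiteRankAlgebra,
      (∀ u v : G.Heisenberg, e (u * v) = e u * e v) ∧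
      ∀ (a : A) (b : G.Dual) (x : A),
        (e (QGroup.AlgebraicQuantumGroup.Heisenberg.tmul G a b) : Module.End ℂ A) x =
          a * G.act b x := by
  let e : G.Heisenberg ≃ₗ[ℂ] G.finiteRankAlgebra :=
    (LinearEquiv.ofInjective G.heisenbergAction G.heisenbergAction_injective).trans
      (LinearEquiv.ofEq _ _ G.range_heisenbergAction)
  exact ⟨e, fun u v => Subtype.ext (G.heisenbergAction_mul u v), fun a b x => rfl⟩
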